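/- Let $m\ge 3$ and let $k,\ell\ge 0$ be integers. For $x\in\mathbb{R}^m$ and $v\in\mathbb{C}^m$ put $\langle x,v\rangle=\sum_{j} x_jv_j$, and for orthogonal unit vectors $t,s\in\mathbb{R}^m$ put $\tau=t+is$ and $\tau^\dagger=-t+is$. Let $A_d=2\pi^{d/2}/\Gamma(d/2)$, and for $x,y\in\mathbb{R}^m$ let $$L_{k,\ell}(x,y)=\frac{1}{A_mA_{m-1}}\int_{\mathbb{S}^{m-1}}\int_{\mathbb{S}^{m-2}}\langle x,\tau\rangle^{k}\langle x,\tau^\dagger\rangle^{\ell}\langle y,\tau\rangle^{\ell}\langle y,\tau^\dagger\rangle^{k}\,dS(s)\,dS(t),$$ where $\mathbb{S}^{m-2}$ denotes the unit sphere of the hyperplane orthogonal to $t$ and $dS$ is surface measure. Let $$K_{m,r}(x,y)=\frac{2r+m-2}{m-2}\,|x|^r|y|^r\,C_r^{\frac m2-1}\!\left(\frac{\langle x,y\rangle}{|x||y|}\right)$$ be the zonal spherical harmonic of degree $r$, where $C_r^{\lambda}$ is the Gegenbauer polynomial; if $x=0$ or $y=0$, then $K_{m,r}(x,y)$ means $1$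 for $r=0$ and $0$ for $r\ge 1$. Then there are unique constants $\theta_{n,k,\ell}\in\mathbb{C}$, $0\le n\le\min(k,\ell)$, such that $$L_{k,\ell}(x,y)=\sum_{n=0}^{\min(k,\ell)}\theta_{n,k,\ell}\,|x|^{2n}K_{m,k+\ell-2n}(x,y)\,|y|^{2n}\qquad\text{for all }x,y\in\mathbb{R}^m,$$ and they are given, for $0\le n\le\min(k,\ell)$, by $$\theta_{n,k,\ell}=(-1)^{k+\ell}\,\frac{\Gamma(m-1)\,\Gamma\left(\frac m2+k-n-1\right)\Gamma\left(\frac m2+\ell-n-1\right)(m-2)}{4\,(\ell-n)!\;\Gamma\left(\frac m2+k+\ell-n\right)^2\,\Gamma(m+k+\ell-2n-2)}\left(\frac{k!\,\ell!}{n!}\right)^2\frac{(k+\ell-2n)!}{(k-n)!}.$$ -/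

import Mathlib

open MeasureTheory

namespace HuaRadon

/-- The surface measure `dS` on the unit sphere of a finite-dimensional real inner product space,
obtained from the canonical Lebesgue measure `volume` of that space. -/
noncomputable def surfaceMeasure (F : Type*) [NormedAddCommGroup F] [InnerProductSpace ℝ F]
    [FiniteDimensional ℝ F] [MeasurableSpace F] [BorelSpace F] :
    Measure (Metric.sphere (0 : F) 1) :=
  (volume : Measure F).toSphere

/-- The area `A_d = 2 π^(d/2) / Γ(d/2)` of the unit sphere in dimension `d`. -/
noncomputable def sphereArea (d : ℝ) : ℝ :=
  2 * Real.pi ^ (d / 2) / Real.Gamma (d / 2)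

/-- The complex bilinear (not sesquilinear) pairing `⟨x, v⟩ = ∑ j, x_j v_j` of a real vector `x`
with a complex vector `v`. -/
noncomputable def pairing {m : ℕ} (x : EuclideanSpace ℝ (Fin m)) (v : Fin m → ℂ) : ℂ :=
  ∑ j, (x j : ℂ) * v j

/-- The vector `τ = t + i s`. -/
noncomputable def tau {m : ℕ} (t s : EuclideanSpace ℝ (Fin m)) : Fin m → ℂ :=
  fun j => (t j : ℂ) + Complex.I * (s j : ℂ)

/-- The Hermitian conjugate of a complex 1-vector of the Clifford algebra: as `e_j† = -e_j`,
the components of `v†` are `-conj v_j`. -/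
noncomputable def dagger {m : ℕ} (v : Fin m → ℂ) : Fin m → ℂ :=
  fun j => -(starRingEnd ℂ) (v j)

/-- For `τ = t + i s` one has `τ† = -t + i s`. -/
theorem dagger_tau {m : ℕ} (t s : EuclideanSpace ℝ (Fin m)) :
    dagger (tau t s) = fun j => -(t j : ℂ) + Complex.I * (s j : ℂ) := by
  funext j
  simp [dagger, tau]
  ring

/-- The dual Radon transform of a function of `τ = t + i s`: the normalized integral over all
`t` in the unit sphere of `ℝ^m` and all `s` in the unit sphere of the hyperplane `t^⊥`. -/
noncomputable def dualRadon {m : ℕ} (F : (Fin m → ℂ) → ℂ) : ℂ :=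
  1 / ((sphereArea m : ℂ) * (sphereArea ((m : ℝ) - 1) : ℂ)) *
    ∫ t : Metric.sphere (0 : EuclideanSpace ℝ (Fin m)) 1,
      (∫ s : Metric.sphere (0 : (ℝ ∙ (t : EuclideanSpace ℝ (Fin m)))ᗮ) 1,
        F (tau (t : EuclideanSpace ℝ (Fin m))
          ((s : (ℝ ∙ (t : EuclideanSpace ℝ (Fin m)))ᗮ) : EuclideanSpace ℝ (Fin m)))
        ∂(surfaceMeasure ((ℝ ∙ (t : EuclideanSpace ℝ (Fin m)))ᗮ)))
      ∂(surfaceMeasure (EuclideanSpace ℝ (Fin m)))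

/-- The Gegenbauer polynomial
`C_r^lam(u) = ∑_{0 ≤ j ≤ r/2} (-1)^j (lam)_{r-j} / (j! (r-2j)!) (2u)^(r-2j)`,
where `(lam)_i` is the rising factorial. -/
noncomputable def gegenbauer (lam : ℝ) (r : ℕ) (u : ℝ) : ℝ :=
  ∑ j ∈ Finset.range (r / 2 + 1),
    (-1) ^ j * (ascPochhammer ℝ (r - j)).eval lam /
      ((Nat.factorial j : ℝ) * (Nat.factorial (r - 2 * j) : ℝ)) * (2 * u) ^ (r - 2 * j)

/-- The zonal spherical harmonic
`K_{m,r}(x,y) = (2r+m-2)/(m-2) |x|^r |y|^r C_r^(m/2-1)(⟨x,y⟩/(|x||y|))`. When `x` or `y` vanishes,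
the value is the one of the polynomial extension: `1` if `r = 0` and `0` otherwise. -/
noncomputable def zonal (m r : ℕ) (x y : EuclideanSpace ℝ (Fin m)) : ℝ :=
  (2 * (r : ℝ) + m - 2) / ((m : ℝ) - 2) * ‖x‖ ^ r * ‖y‖ ^ r *
    gegenbauer ((m : ℝ) / 2 - 1) r (inner ℝ x y / (‖x‖ * ‖y‖))

end HuaRadon

/-! The kernel L_{k,l} is a polynomial in (x, y), homogeneous of degree N = k + l in each vector and
invariant under simultaneous isometries. Hence it is a combination of the monomials ⟨x,y⟩^(N-2j)
|x|^(2j) |y|^(2j), and by triangularity of the products |x|^(2n) K_{m,N-2n} |y|^(2n). The latter are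
linearly independent, which gives uniqueness.

The coefficients follow by induction on k + l from two differential operators. Since τ and τ† are
isotropic with ⟨τ,τ†⟩ = -2, one has Δ_x Δ_y L_{k,l} = 16 k² l² L_{k-1,l-1} and ⟨∂_x,∂_y⟩ L_{k,l} =
-2k² L_{k-1,l} - 2l² L_{k,l-1} (`mixedLaplacian_radonPoly_iterate`,
`mixedLaplacian_inl_inr_radonPoly`). On the other side K_{m,r} is harmonic in x and in y, so Δ_x Δ_y
sends the n-th product of degree N to a nonzero multiple of the (n-1)-st product of degree N - 2.
Comparison determines θ_{n+1,k,l} from θ_{n,k-1,l-1}, and shows that it vanishes when kl = 0.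

Only θ_{0,k,l} escapes, because Δ_x kills K_{m,N}. It is found by evaluating the ⟨∂_x,∂_y⟩ identity
at a complex point with |x|² = 0 and |y|² = ⟨x,y⟩ = 1, where almost every term drops out. What
remains is a recurrence for the coefficient of ⟨x,y⟩^N, solved by `topCoeff`. Differentiation under
the integral is purely algebraic: the integrand is a polynomial with coefficients in C(Frame m, ℂ),
and the mean acts on coefficients. -/

namespace HuaRadon
open MvPolynomial

/-! ### Second-order operators on monomials in ⟨x,y⟩, |x|², |y|² -/

section Operators

variable {m : ℕ} {R : Type*} [CommRing R]

/-- The second-order operator `∑ i, ∂_{a i} ∂_{b i}` on polynomials. -/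
noncomputable def mixedLaplacian {σ : Type*} (a b : Fin m → σ) :
    MvPolynomial σ R →ₗ[R] MvPolynomial σ R :=
  ∑ i, (pderiv (a i)).toLinearMap ∘ₗ (pderiv (b i)).toLinearMap

theorem mixedLaplacian_apply {σ : Type*} (a b : Fin m → σ) (f : MvPolynomial σ R) :
    mixedLaplacian a b f = ∑ i, pderiv (a i) (pderiv (b i) f) := by
  simp [mixedLaplacian, LinearMap.sum_apply]

/-- The polynomial `⟨x, x⟩` in the variables `(x, y)`. -/
noncomputable def normSqX (m : ℕ) (R : Type*) [CommRing R] : MvPolynomial (Fin m ⊕ Fin m) R :=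
  ∑ i, X (Sum.inl i) ^ 2

/-- The polynomial `⟨y, y⟩` in the variables `(x, y)`. -/
noncomputable def normSqY (m : ℕ) (R : Type*) [CommRing R] : MvPolynomial (Fin m ⊕ Fin m) R :=
  ∑ i, X (Sum.inr i) ^ 2

/-- The polynomial `⟨x, y⟩` in the variables `(x, y)`. -/
noncomputable def innerXY (m : ℕ) (R : Type*) [CommRing R] : MvPolynomial (Fin m ⊕ Fin m) R :=
  ∑ i, X (Sum.inl i) * X (Sum.inr i)

@[simp] theorem pderiv_inl_normSqX (i : Fin m) :
    pderiv (Sum.inl i) (normSqX m R) = 2 * X (Sum.inl i) := by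
  simp [normSqX, pderiv_X, Pi.single_apply]

@[simp] theorem pderiv_inr_normSqX (i : Fin m) : pderiv (Sum.inr i) (normSqX m R) = 0 := by
  simp [normSqX, pderiv_X]

@[simp] theorem pderiv_inl_normSqY (i : Fin m) : pderiv (Sum.inl i) (normSqY m R) = 0 := by
  simp [normSqY, pderiv_X]

@[simp] theorem pderiv_inr_normSqY (i : Fin m) :
    pderiv (Sum.inr i) (normSqY m R) = 2 * X (Sum.inr i) := by
  simp [normSqY, pderiv_X, Pi.single_apply]

@[simp] theorem pderiv_inl_innerXY (i : Fin m) :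
    pderiv (Sum.inl i) (innerXY m R) = X (Sum.inr i) := by
  simp [innerXY, pderiv_X, Pi.single_apply]

@[simp] theorem pderiv_inr_innerXY (i : Fin m) :
    pderiv (Sum.inr i) (innerXY m R) = X (Sum.inl i) := by
  simp [innerXY, pderiv_X, Pi.single_apply]

/-- The factor n absorbs the truncation of n - 1 at n = 0, so the operator formulas below hold for
all exponents without case distinctions. -/
theorem natCast_mul_pow_pred_mul {A : Type*} [CommRing A] (n : ℕ) (x : A) :
    (n : A) * x ^ (n - 1) * x = n * x ^ n := by
  cases n <;> simp [pow_succ]; ring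

theorem pred_mul_pow_sub_mul {A : Type*} [CommRing A] (n : ℕ) (x : A) :
    (n : A) * ((n - 1 : ℕ) : A) * x ^ (n - 1 - 1) * x = (n : A) * ((n : A) - 1) * x ^ (n - 1) := by
  rcases n with _ | _ | n <;> simp [pow_succ]; ring

theorem mixedLaplacian_inl_inl_monomial (a b c : ℕ) :
    mixedLaplacian Sum.inl Sum.inl
        (innerXY m R ^ a * normSqX m R ^ b * normSqY m R ^ c) =
      (a : MvPolynomial (Fin m ⊕ Fin m) R) * ((a : MvPolynomial (Fin m ⊕ Fin m) R) - 1) *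
          (innerXY m R ^ (a - 2) * normSqX m R ^ b * normSqY m R ^ (c + 1)) +
        2 * b * (2 * b + 2 * a + m - 2) *
          (innerXY m R ^ a * normSqX m R ^ (b - 1) * normSqY m R ^ c) := by
  set U := innerXY m R with hU
  set P := normSqX m R with hP
  set Q := normSqY m R with hQ
  set xv : Fin m → MvPolynomial (Fin m ⊕ Fin m) R := fun i => X (Sum.inl i) with hxv
  set yv : Fin m → MvPolynomial (Fin m ⊕ Fin m) R := fun i => X (Sum.inr i) with hyv
  have h1 : ∀ i : Fin m, pderiv (Sum.inl i) (pderiv (Sum.inl i) (U ^ a * P ^ b * Q ^ c)) =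
      (a : MvPolynomial (Fin m ⊕ Fin m) R) * ((a - 1 : ℕ) : MvPolynomial (Fin m ⊕ Fin m) R) *
          U ^ (a - 1 - 1) * P ^ b * Q ^ c * yv i ^ 2 +
        4 * a * b * U ^ (a - 1) * P ^ (b - 1) * Q ^ c * (xv i * yv i) +
        4 * (b * ((b - 1 : ℕ) : MvPolynomial (Fin m ⊕ Fin m) R)) * P ^ (b - 1 - 1) * U ^ a * Q ^ c *
          xv i ^ 2 +
        2 * b * P ^ (b - 1) * U ^ a * Q ^ c := by
    intro i
    simp only [hU, hP, hQ, hxv, hyv, pderiv_mul, pderiv_pow, map_add, pderiv_inl_innerXY, pderiv_inl_normSqX,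
      pderiv_inl_normSqY, pderiv_X_self, Derivation.map_natCast, map_zero]
    have : pderiv (Sum.inl i) (X (Sum.inr i) : MvPolynomial (Fin m ⊕ Fin m) R) = 0 :=
      pderiv_X_of_ne (by simp)
    have h2 : pderiv (Sum.inl i) (2 : MvPolynomial (Fin m ⊕ Fin m) R) = 0 :=
      Derivation.map_natCast _ 2
    rw [this, h2]
    ring
  rw [mixedLaplacian_apply, Finset.sum_congr rfl fun i _ => h1 i]
  simp only [Finset.sum_add_distrib, ← Finset.mul_sum]
  have e1 : ∑ i, yv i ^ 2 = Q := rfl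
  have e2 : ∑ i, xv i * yv i = U := rfl
  have e3 : ∑ i, xv i ^ 2 = P := rfl
  rw [e1, e2, e3, Finset.sum_const, Finset.card_univ, Fintype.card_fin, nsmul_eq_mul]
  have q1 := natCast_mul_pow_pred_mul a U
  have q2 := pred_mul_pow_sub_mul b P
  have q3 : (a : MvPolynomial (Fin m ⊕ Fin m) R) *
      ((a - 1 : ℕ) : MvPolynomial (Fin m ⊕ Fin m) R) =
        a * ((a : MvPolynomial (Fin m ⊕ Fin m) R) - 1) := by
    cases a <;> simp
  rw [q3, show a - 1 - 1 = a - 2 by omega]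
  linear_combination (4 * b * P ^ (b - 1) * Q ^ c) * q1 + 4 * U ^ a * Q ^ c * q2

theorem mixedLaplacian_inl_inr_monomial (a b c : ℕ) :
    mixedLaplacian Sum.inl Sum.inr
        (innerXY m R ^ a * normSqX m R ^ b * normSqY m R ^ c) =
      (a : MvPolynomial (Fin m ⊕ Fin m) R) * (m + a - 1 + 2 * b + 2 * c) *
          (innerXY m R ^ (a - 1) * normSqX m R ^ b * normSqY m R ^ c) +
        4 * b * c *
          (innerXY m R ^ (a + 1) * normSqX m R ^ (b - 1) * normSqY m R ^ (c - 1)) := by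
  set U := innerXY m R with hU
  set P := normSqX m R with hP
  set Q := normSqY m R with hQ
  set xv : Fin m → MvPolynomial (Fin m ⊕ Fin m) R := fun i => X (Sum.inl i) with hxv
  set yv : Fin m → MvPolynomial (Fin m ⊕ Fin m) R := fun i => X (Sum.inr i) with hyv
  have h1 : ∀ i : Fin m, pderiv (Sum.inl i) (pderiv (Sum.inr i) (U ^ a * P ^ b * Q ^ c)) =
      ((a : MvPolynomial (Fin m ⊕ Fin m) R) * ((a - 1 : ℕ) : MvPolynomial (Fin m ⊕ Fin m) R) *
          U ^ (a - 1 - 1) * P ^ b * Q ^ c + 4 * (b * c) * U ^ a * P ^ (b - 1) * Q ^ (c - 1)) *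
            (xv i * yv i) +
        2 * a * c * U ^ (a - 1) * P ^ b * Q ^ (c - 1) * yv i ^ 2 +
        2 * a * b * U ^ (a - 1) * P ^ (b - 1) * Q ^ c * xv i ^ 2 +
        a * U ^ (a - 1) * P ^ b * Q ^ c := by
    intro i
    simp only [hU, hP, hQ, hxv, hyv, pderiv_mul, pderiv_pow, map_add, pderiv_inl_innerXY, pderiv_inl_normSqX,
      pderiv_inr_innerXY, pderiv_inr_normSqX, pderiv_inr_normSqY,
      pderiv_inl_normSqY, pderiv_X_self, Derivation.map_natCast, map_zero]
    have : pderiv (Sum.inl i) (X (Sum.inr i) : MvPolynomial (Fin m ⊕ Fin m) R) = 0 :=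
      pderiv_X_of_ne (by simp)
    have h2 : pderiv (Sum.inl i) (2 : MvPolynomial (Fin m ⊕ Fin m) R) = 0 :=
      Derivation.map_natCast _ 2
    rw [this, h2]
    ring
  rw [mixedLaplacian_apply, Finset.sum_congr rfl fun i _ => h1 i]
  simp only [Finset.sum_add_distrib, ← Finset.mul_sum]
  have e1 : ∑ i, yv i ^ 2 = Q := rfl
  have e2 : ∑ i, xv i * yv i = U := rfl
  have e3 : ∑ i, xv i ^ 2 = P := rfl
  rw [e1, e2, e3, Finset.sum_const, Finset.card_univ, Fintype.card_fin, nsmul_eq_mul]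
  have q1 := pred_mul_pow_sub_mul a U
  have q2 := natCast_mul_pow_pred_mul b P
  have q3 := natCast_mul_pow_pred_mul c Q
  linear_combination (P ^ b * Q ^ c) * q1 + 2 * a * U ^ (a - 1) * Q ^ c * q2 +
    2 * a * U ^ (a - 1) * P ^ b * q3

end Operators

/-! ### Zonal harmonics as polynomials: harmonicity, independence, spanning -/

section Zonal

/-- The coefficient of `⟨x, y⟩^(r - 2 j) |x|^(2 j) |y|^(2 j)` in the zonal harmonic `K_{m,r}`. -/
noncomputable def zonalCoeff (m r j : ℕ) : ℝ :=
  (2 * (r : ℝ) + m - 2) / ((m : ℝ) - 2) *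
    ((-1) ^ j * (ascPochhammer ℝ (r - j)).eval ((m : ℝ) / 2 - 1) /
      ((Nat.factorial j : ℝ) * (Nat.factorial (r - 2 * j) : ℝ)) * 2 ^ (r - 2 * j))

/-- The zonal harmonic `K_{m,r}` as a polynomial in `(x, y)`. -/
noncomputable def zonalPoly (m r : ℕ) : MvPolynomial (Fin m ⊕ Fin m) ℂ :=
  ∑ j ∈ Finset.range (r / 2 + 1), C (zonalCoeff m r j : ℂ) *
    (innerXY m ℂ ^ (r - 2 * j) * normSqX m ℂ ^ j * normSqY m ℂ ^ j)

theorem zonalCoeff_zero_pos {m : ℕ} (hm : 3 ≤ m) (r : ℕ) : 0 < zonalCoeff m r 0 := by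
  have hm' : (3 : ℝ) ≤ m := by exact_mod_cast hm
  have h1 : 0 < (ascPochhammer ℝ r).eval ((m : ℝ) / 2 - 1) :=
    ascPochhammer_pos r _ (by linarith)
  have h2 : (0 : ℝ) ≤ r := Nat.cast_nonneg r
  have h3 : 0 < 2 * (r : ℝ) + m - 2 := by linarith
  have h4 : 0 < (m : ℝ) - 2 := by linarith
  have h5 : (0 : ℝ) < Nat.factorial r := by exact_mod_cast Nat.factorial_pos r
  simp only [zonalCoeff, pow_zero, Nat.sub_zero, mul_zero, Nat.factorial_zero, Nat.cast_one,
    one_mul]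
  positivity

/-- This two-term recurrence is harmonicity of K_{m,r} read off coefficient by coefficient. -/
theorem zonalCoeff_succ {m r j : ℕ} (hj : 2 * (j + 1) ≤ r) :
    ((r : ℝ) - 2 * j) * ((r : ℝ) - 2 * j - 1) * zonalCoeff m r j +
      2 * ((j : ℝ) + 1) * (2 * r - 2 * j + m - 4) * zonalCoeff m r (j + 1) = 0 := by
  obtain ⟨a, rfl⟩ := Nat.exists_eq_add_of_le hj
  unfold zonalCoeff
  rw [show 2 * (j + 1) + a - j = (j + 1 + a) + 1 by omega,
    show 2 * (j + 1) + a - (j + 1) = j + 1 + a by omega,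
    show 2 * (j + 1) + a - 2 * j = a + 1 + 1 by omega,
    show 2 * (j + 1) + a - 2 * (j + 1) = a by omega, ascPochhammer_succ_eval,
    Nat.factorial_succ (a + 1), Nat.factorial_succ a, Nat.factorial_succ j]
  have ha : (Nat.factorial a : ℝ) ≠ 0 := by exact_mod_cast Nat.factorial_ne_zero a
  have hj : (Nat.factorial j : ℝ) ≠ 0 := by exact_mod_cast Nat.factorial_ne_zero j
  have ha1 : (a : ℝ) + 1 ≠ 0 := by positivity
  have ha2 : (a : ℝ) + 1 + 1 ≠ 0 := by positivity
  have hj1 : (j : ℝ) + 1 ≠ 0 := by positivity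
  set e := (ascPochhammer ℝ (j + 1 + a)).eval ((m : ℝ) / 2 - 1)
  push_cast
  set B := (2 * (2 * ((j : ℝ) + 1) + a) + m - 2) / ((m : ℝ) - 2)
  field_simp
  ring

theorem zonalCoeff_one {m : ℕ} (hm : 3 ≤ m) {r : ℕ} (hr : 2 ≤ r) :
    zonalCoeff m r 1 = -((r : ℝ) * (r - 1)) / (2 * (2 * r + m - 4)) * zonalCoeff m r 0 := by
  have h := zonalCoeff_succ (m := m) (r := r) (j := 0) (by omega)
  have hm' : (3 : ℝ) ≤ m := by exact_mod_cast hm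
  have hr' : (2 : ℝ) ≤ r := by exact_mod_cast hr
  have h3 : 2 * (r : ℝ) + m - 4 ≠ 0 := by nlinarith
  rw [zero_add] at h
  push_cast at h
  rw [div_mul_eq_mul_div, eq_div_iff (mul_ne_zero two_ne_zero h3)]
  linear_combination h

/-- For H harmonic and homogeneous of degree r, Δ(|x|^(2b) H) = 2b(2b + 2r + m - 2) |x|^(2b-2) H. At
b = 0 the scalar vanishes, so the truncated exponent is harmless and the formula expresses
harmonicity itself. -/
theorem mixedLaplacian_inl_inl_zonalPoly (m r b c : ℕ) :
    mixedLaplacian Sum.inl Sum.inl (zonalPoly m r * normSqX m ℂ ^ b * normSqY m ℂ ^ c) =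
      C (2 * b * (2 * b + 2 * r + m - 2) : ℂ) *
        (zonalPoly m r * normSqX m ℂ ^ (b - 1) * normSqY m ℂ ^ c) := by
  set U := innerXY m ℂ with hU
  set P := normSqX m ℂ with hP
  set Q := normSqY m ℂ with hQ
  set κ : ℕ → MvPolynomial (Fin m ⊕ Fin m) ℂ := fun j => C (zonalCoeff m r j : ℂ) with hκ
  have hexp : ∀ b', zonalPoly m r * P ^ b' * Q ^ c = ∑ j ∈ Finset.range (r / 2 + 1),
      κ j * (U ^ (r - 2 * j) * P ^ (b' + j) * Q ^ (c + j)) := by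
    intro b'
    rw [zonalPoly, Finset.sum_mul, Finset.sum_mul]
    refine Finset.sum_congr rfl fun j _ => ?_
    rw [pow_add, pow_add]; ring
  rw [hexp, hexp, map_sum]
  set l : MvPolynomial (Fin m ⊕ Fin m) ℂ := C (2 * b * (2 * b + 2 * r + m - 2) : ℂ) with hl
  have hl' : l = 2 * b * (2 * b + 2 * r + m - 2) := by
    rw [hl]
    simp only [map_mul, map_add, map_sub, map_natCast, map_ofNat]
  have hterm : ∀ j ∈ Finset.range (r / 2 + 1),
      mixedLaplacian Sum.inl Sum.inl (κ j * (U ^ (r - 2 * j) * P ^ (b + j) * Q ^ (c + j))) =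
      l * (κ j * (U ^ (r - 2 * j) * P ^ (b - 1 + j) * Q ^ (c + j))) +
      (κ j * (((r : MvPolynomial (Fin m ⊕ Fin m) ℂ) - 2 * j) * (r - 2 * j - 1)) *
        (U ^ (r - 2 * j - 2) * P ^ (b + j) * Q ^ (c + j + 1)) +
       κ j * (2 * j * (2 * r - 2 * j + m - 2)) *
        (U ^ (r - 2 * j) * P ^ (b + j - 1) * Q ^ (c + j))) := by
    intro j hj
    have hj' : 2 * j ≤ r := by rw [Finset.mem_range] at hj; omega
    rw [show κ j = C (zonalCoeff m r j : ℂ) from rfl, ← smul_eq_C_mul, map_smul,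
      mixedLaplacian_inl_inl_monomial, smul_eq_C_mul, hl', Nat.cast_sub hj']
    push_cast
    rcases b with _ | b
    · simp only [Nat.cast_zero]
      ring
    · rw [show b + 1 - 1 + j = b + j by omega, show b + 1 + j - 1 = b + j by omega]
      push_cast
      ring
  -- After the expected multiple is split off, two families remain. They cancel once shifted by one
  -- index: the j = 0 term of the second has the factor j, and the last term of the first has the
  -- factor (r - 2j)(r - 2j - 1), zero for j = r / 2 in either parity.
  rw [Finset.sum_congr rfl hterm, Finset.sum_add_distrib, ← Finset.mul_sum, add_eq_left,
    Finset.sum_add_distrib, Finset.sum_range_succ, Finset.sum_range_succ']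
  have hlast : ((r : MvPolynomial (Fin m ⊕ Fin m) ℂ) -
      2 * ((r / 2 : ℕ) : MvPolynomial (Fin m ⊕ Fin m) ℂ)) *
      ((r : MvPolynomial (Fin m ⊕ Fin m) ℂ) -
        2 * ((r / 2 : ℕ) : MvPolynomial (Fin m ⊕ Fin m) ℂ) - 1) = 0 := by
    have : r = 2 * (r / 2) ∨ r = 2 * (r / 2) + 1 := by omega
    rcases this with h | h
    · have : (r : MvPolynomial (Fin m ⊕ Fin m) ℂ) = 2 * ((r / 2 : ℕ) : MvPolynomial _ ℂ) := by
        exact_mod_cast h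
      linear_combination ((r : MvPolynomial (Fin m ⊕ Fin m) ℂ) -
        2 * ((r / 2 : ℕ) : MvPolynomial _ ℂ) - 1) * this
    · have : (r : MvPolynomial (Fin m ⊕ Fin m) ℂ) = 2 * ((r / 2 : ℕ) : MvPolynomial _ ℂ) + 1 := by
        exact_mod_cast h
      linear_combination ((r : MvPolynomial (Fin m ⊕ Fin m) ℂ) -
        2 * ((r / 2 : ℕ) : MvPolynomial _ ℂ)) * this
  rw [hlast]
  simp only [Nat.cast_zero, mul_zero, zero_mul, add_zero]
  rw [← Finset.sum_add_distrib]
  refine Finset.sum_eq_zero fun j hj => ?_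
  have hj' : 2 * (j + 1) ≤ r := by rw [Finset.mem_range] at hj; omega
  have hrec : ((r : MvPolynomial (Fin m ⊕ Fin m) ℂ) - 2 * j) * (r - 2 * j - 1) * κ j +
      2 * (j + 1) * (2 * r - 2 * j + m - 4) * κ (j + 1) = 0 := by
    have h := congrArg (fun z : ℝ => (C (z : ℂ) : MvPolynomial (Fin m ⊕ Fin m) ℂ))
      (zonalCoeff_succ (m := m) hj')
    push_cast at h
    simp only [map_mul, map_add, map_sub, map_natCast, map_ofNat, map_one, map_zero] at h
    exact h
  rw [show r - 2 * (j + 1) = r - 2 * j - 2 by omega, show b + (j + 1) - 1 = b + j by omega,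
    show c + (j + 1) = c + j + 1 by omega]
  push_cast
  linear_combination (U ^ (r - 2 * j - 2) * P ^ (b + j) * Q ^ (c + j + 1)) * hrec

theorem rename_swap_normSqX (m : ℕ) (R : Type*) [CommRing R] :
    rename Sum.swap (normSqX m R) = normSqY m R := by
  simp [normSqX, normSqY]

theorem rename_swap_normSqY (m : ℕ) (R : Type*) [CommRing R] :
    rename Sum.swap (normSqY m R) = normSqX m R := by
  simp [normSqX, normSqY]

theorem rename_swap_innerXY (m : ℕ) (R : Type*) [CommRing R] :
    rename Sum.swap (innerXY m R) = innerXY m R := by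
  simp [innerXY, mul_comm]

theorem rename_swap_zonalPoly (m r : ℕ) :
    rename Sum.swap (zonalPoly m r) = zonalPoly m r := by
  simp only [zonalPoly, map_sum, map_mul, map_pow, rename_swap_normSqX, rename_swap_normSqY,
    rename_swap_innerXY, rename_C]
  exact Finset.sum_congr rfl fun j _ => by ring

theorem mixedLaplacian_inr_inr_rename_swap {m : ℕ} {R : Type*} [CommRing R]
    (f : MvPolynomial (Fin m ⊕ Fin m) R) :
    mixedLaplacian Sum.inr Sum.inr (rename Sum.swap f) =
      rename Sum.swap (mixedLaplacian Sum.inl Sum.inl f) := by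
  have hs : Function.Injective (Sum.swap : Fin m ⊕ Fin m → _) :=
    Sum.swap_leftInverse.injective
  rw [mixedLaplacian_apply, mixedLaplacian_apply, map_sum]
  refine Finset.sum_congr rfl fun i _ => ?_
  rw [show (Sum.inr i : Fin m ⊕ Fin m) = Sum.swap (Sum.inl i) from rfl, pderiv_rename hs,
    pderiv_rename hs]

theorem mixedLaplacian_inr_inr_zonalPoly (m r b c : ℕ) :
    mixedLaplacian Sum.inr Sum.inr (zonalPoly m r * normSqX m ℂ ^ b * normSqY m ℂ ^ c) =
      C (2 * c * (2 * c + 2 * r + m - 2) : ℂ) *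
        (zonalPoly m r * normSqX m ℂ ^ b * normSqY m ℂ ^ (c - 1)) := by
  have h := mixedLaplacian_inl_inl_zonalPoly m r c b
  apply_fun rename Sum.swap at h
  rw [← mixedLaplacian_inr_inr_rename_swap] at h
  simp only [map_mul, map_pow, rename_swap_normSqX, rename_swap_normSqY, rename_swap_zonalPoly,
    rename_C] at h
  rw [mul_right_comm, h]
  simp only [map_mul]
  ring

theorem mixedLaplacian_inr_inr_inl_inl_zonalPoly (m r n : ℕ) :
    mixedLaplacian Sum.inr Sum.inr (mixedLaplacian Sum.inl Sum.inl
        (zonalPoly m r * normSqX m ℂ ^ n * normSqY m ℂ ^ n)) =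
      C ((2 * n * (2 * n + 2 * r + m - 2) : ℂ) ^ 2) *
        (zonalPoly m r * normSqX m ℂ ^ (n - 1) * normSqY m ℂ ^ (n - 1)) := by
  rw [mixedLaplacian_inl_inl_zonalPoly, ← smul_eq_C_mul, map_smul,
    mixedLaplacian_inr_inr_zonalPoly, smul_eq_C_mul, pow_two, ← mul_assoc, ← C_mul]

/-- Complex coordinates are essential: for real vectors Cauchy–Schwarz would force |x|² ≥ 1, whereas
the value |x|² = 0 is needed later. -/
theorem exists_eval_normSqX_eq {m : ℕ} (hm : 2 ≤ m) (p : ℂ) :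
    ∃ a : Fin m ⊕ Fin m → ℂ, eval a (normSqX m ℂ) = p ∧ eval a (normSqY m ℂ) = 1 ∧
      eval a (innerXY m ℂ) = 1 := by
  obtain ⟨m, rfl⟩ := Nat.exists_eq_add_of_le' hm
  obtain ⟨h, hh⟩ := IsAlgClosed.exists_pow_nat_eq (p - 1) (n := 2) (by norm_num)
  refine ⟨Sum.elim (Fin.cons 1 (Fin.cons h 0)) (Fin.cons 1 0), ?_, ?_, ?_⟩
  · simp [normSqX, Fin.sum_univ_succ, hh]
  · simp [normSqY, Fin.sum_univ_succ]
  · simp [innerXY, Fin.sum_univ_succ]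

/-- The restriction of `K_{m,r}` to `|y|² = ⟨x, y⟩ = 1`, as a polynomial in `|x|²`. -/
noncomputable def zonalUnivariate (m r : ℕ) : Polynomial ℂ :=
  ∑ j ∈ Finset.range (r / 2 + 1), Polynomial.C (zonalCoeff m r j : ℂ) * Polynomial.X ^ j

theorem zonalUnivariate_coeff_zero (m r : ℕ) :
    (zonalUnivariate m r).coeff 0 = zonalCoeff m r 0 := by
  simp [zonalUnivariate, Polynomial.coeff_X_pow]

theorem eval_zonalPoly_eq (m r : ℕ) (a : Fin m ⊕ Fin m → ℂ)
    (hy : eval a (normSqY m ℂ) = 1) (hu : eval a (innerXY m ℂ) = 1) :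
    eval a (zonalPoly m r) = (zonalUnivariate m r).eval (eval a (normSqX m ℂ)) := by
  simp [zonalPoly, zonalUnivariate, hy, hu, Polynomial.eval_finsetSum]

/-- On the slice |y|² = ⟨x,y⟩ = 1 the n-th product becomes p^n times a polynomial in p = |x|² with
nonzero constant term. The system is therefore triangular. Nothing depends on 2n ≤ N, as the leading
coefficient is positive in every degree. -/
theorem zonalPoly_independent {m : ℕ} (hm : 3 ≤ m) (N M : ℕ) (c : ℕ → ℂ)
    (h : ∑ n ∈ Finset.range M,
      C (c n) * (zonalPoly m (N - 2 * n) * normSqX m ℂ ^ n * normSqY m ℂ ^ n) = 0) :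
    ∀ n < M, c n = 0 := by
  have hF : ∑ n ∈ Finset.range M,
      Polynomial.C (c n) * (zonalUnivariate m (N - 2 * n) * Polynomial.X ^ n) = 0 := by
    refine Polynomial.funext fun p => ?_
    obtain ⟨a, hp, hy, hu⟩ := exists_eval_normSqX_eq (by omega : 2 ≤ m) p
    have := congrArg (eval a) h
    simpa [Polynomial.eval_finsetSum, hy, eval_zonalPoly_eq m _ a hy hu, hp] using this
  intro n
  induction n using Nat.strong_induction_on with
  | _ n ih =>
    intro hn
    have hc := congrArg (fun f => Polynomial.coeff f n) hF
    simp only [Polynomial.finsetSum_coeff, Polynomial.coeff_C_mul, Polynomial.coeff_zero,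
      Polynomial.coeff_mul_X_pow'] at hc
    rw [Finset.sum_eq_single n] at hc
    · simp only [le_refl, if_true, Nat.sub_self, zonalUnivariate_coeff_zero, mul_eq_zero,
        Complex.ofReal_eq_zero] at hc
      exact hc.resolve_right (zonalCoeff_zero_pos hm _).ne'
    · intro i hi hin
      rcases lt_or_gt_of_ne hin with h1 | h1
      · rw [ih i h1 (Finset.mem_range.1 hi), zero_mul]
      · rw [if_neg (by omega), mul_zero]
    · intro hn'
      exact absurd (Finset.mem_range.2 hn) hn'

/-- The span of the polynomials `|x|^(2 n) K_{m,N-2n} |y|^(2 n)` with `2 n ≤ N`. -/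
noncomputable def zonalSpan (m N : ℕ) : Submodule ℂ (MvPolynomial (Fin m ⊕ Fin m) ℂ) :=
  Submodule.span ℂ (Set.range fun n : Fin (N / 2 + 1) =>
    zonalPoly m (N - 2 * n) * normSqX m ℂ ^ (n : ℕ) * normSqY m ℂ ^ (n : ℕ))

theorem mem_zonalSpan_iff {m N : ℕ} {f : MvPolynomial (Fin m ⊕ Fin m) ℂ} :
    f ∈ zonalSpan m N ↔ ∃ c : ℕ → ℂ, f = ∑ n ∈ Finset.range (N / 2 + 1),
      C (c n) * (zonalPoly m (N - 2 * n) * normSqX m ℂ ^ n * normSqY m ℂ ^ n) := by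
  rw [zonalSpan, Submodule.mem_span_range_iff_exists_fun]
  constructor
  · rintro ⟨c, rfl⟩
    refine ⟨fun n => if h : n < N / 2 + 1 then c ⟨n, h⟩ else 0, ?_⟩
    rw [Finset.sum_range]
    exact Finset.sum_congr rfl fun n _ => by simp only [smul_eq_C_mul, n.2, dif_pos]
  · rintro ⟨c, rfl⟩
    refine ⟨fun n => c n, ?_⟩
    rw [Finset.sum_range]
    exact Finset.sum_congr rfl fun n _ => by simp [smul_eq_C_mul]

/-- K_{m,a} is a nonzero multiple of ⟨x,y⟩^a plus terms with smaller powers of ⟨x,y⟩, so the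
triangular change of basis is inverted by induction on a. -/
theorem monomial_mem_zonalSpan {m : ℕ} (hm : 3 ≤ m) (N : ℕ) (a j : ℕ) (h : a + 2 * j = N) :
    innerXY m ℂ ^ a * normSqX m ℂ ^ j * normSqY m ℂ ^ j ∈ zonalSpan m N := by
  induction a using Nat.strong_induction_on generalizing j with
  | _ a ih =>
    have hmem : zonalPoly m a * normSqX m ℂ ^ j * normSqY m ℂ ^ j ∈ zonalSpan m N := by
      have := Submodule.subset_span (R := ℂ) (Set.mem_range_self (f := fun n : Fin (N / 2 + 1) =>
        zonalPoly m (N - 2 * n) * normSqX m ℂ ^ (n : ℕ) * normSqY m ℂ ^ (n : ℕ))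
        ⟨j, by omega⟩)
      rw [zonalSpan]
      simpa [show N - 2 * j = a by omega] using this
    rw [zonalPoly, Finset.sum_mul, Finset.sum_mul, Finset.sum_range_succ'] at hmem
    have hrest : ∑ i ∈ Finset.range (a / 2), C (zonalCoeff m a (i + 1) : ℂ) *
        (innerXY m ℂ ^ (a - 2 * (i + 1)) * normSqX m ℂ ^ (i + 1) * normSqY m ℂ ^ (i + 1)) *
          normSqX m ℂ ^ j * normSqY m ℂ ^ j ∈ zonalSpan m N := by
      refine Submodule.sum_mem _ fun i hi => ?_
      rw [Finset.mem_range] at hi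
      have := Submodule.smul_mem _ (zonalCoeff m a (i + 1) : ℂ)
        (ih (a - 2 * (i + 1)) (by omega) (i + 1 + j) (by omega))
      rw [smul_eq_C_mul] at this
      convert this using 1
      rw [pow_add, pow_add]
      ring
    have h0 := (Submodule.add_mem_iff_right _ hrest).1 hmem
    have hne : (zonalCoeff m a 0 : ℂ) ≠ 0 := by
      exact_mod_cast (zonalCoeff_zero_pos hm a).ne'
    have h1 := Submodule.smul_mem _ (zonalCoeff m a 0 : ℂ)⁻¹ h0
    convert h1 using 1
    simp only [mul_zero, Nat.sub_zero, pow_zero, mul_one, mul_assoc]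
    rw [← smul_eq_C_mul, smul_smul, inv_mul_cancel₀ hne, one_smul]

/-- At an isotropic x a monomial survives only if the operator leaves no factor |x|², and it removes
at most one. So n = 0 receives contributions from j = 0 and j = 1, n = 1 only from j = 0, and n ≥ 2
none. -/
theorem eval_mixedLaplacian_zonalPoly {m : ℕ} (hm : 3 ≤ m) (r n : ℕ) (a : Fin m ⊕ Fin m → ℂ)
    (hx : eval a (normSqX m ℂ) = 0) (hy : eval a (normSqY m ℂ) = 1)
    (hu : eval a (innerXY m ℂ) = 1) :
    eval a (mixedLaplacian Sum.inl Sum.inr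
        (zonalPoly m r * normSqX m ℂ ^ n * normSqY m ℂ ^ n)) =
      if n = 0 then (((r * (m + r - 1) - 2 * (r * (r - 1)) / (2 * r + m - 4)) *
        zonalCoeff m r 0 : ℝ) : ℂ)
      else if n = 1 then 4 * zonalCoeff m r 0 else 0 := by
  have hexp : zonalPoly m r * normSqX m ℂ ^ n * normSqY m ℂ ^ n =
      ∑ j ∈ Finset.range (r / 2 + 1), (zonalCoeff m r j : ℂ) •
        (innerXY m ℂ ^ (r - 2 * j) * normSqX m ℂ ^ (n + j) * normSqY m ℂ ^ (n + j)) := by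
    rw [zonalPoly, Finset.sum_mul, Finset.sum_mul]
    refine Finset.sum_congr rfl fun j _ => ?_
    rw [pow_add, pow_add, smul_eq_C_mul]; ring
  simp only [hexp, map_sum, map_smul, mixedLaplacian_inl_inr_monomial, smul_eval, map_add,
    map_mul, map_pow, hx, hy, hu, one_pow, map_natCast, map_sub, map_one, map_ofNat, mul_one,
    one_mul]
  rcases n with _ | _ | n
  · rw [if_pos rfl, Finset.sum_range_succ']
    rcases lt_or_ge r 2 with hr | hr
    · rw [show r / 2 = 0 by omega]
      have : r = 0 ∨ r = 1 := by omega
      rcases this with rfl | rfl <;> simp; ring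
    · obtain ⟨s, hs⟩ : ∃ s, r / 2 = s + 1 := ⟨r / 2 - 1, by omega⟩
      rw [hs, Finset.sum_range_succ', Finset.sum_eq_zero, zonalCoeff_one hm hr]
      · simp
        have hm' : (3 : ℝ) ≤ m := by exact_mod_cast hm
        have hr' : (2 : ℝ) ≤ r := by exact_mod_cast hr
        have h3 : 2 * (r : ℂ) + m - 4 ≠ 0 := by
          have : 2 * (r : ℝ) + m - 4 ≠ 0 := by nlinarith
          exact_mod_cast this
        field_simp
        ring
      · intro i _
        simp
  · rw [Finset.sum_range_succ', Finset.sum_eq_zero]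
    · simp; ring
    · intro i _
      simp
  · rw [Finset.sum_eq_zero]
    · simp
    · intro i _
      simp

end Zonal
end HuaRadon

namespace HuaRadon

/-! ### Surface measure: isometry invariance and total mass -/

section SphereMeasure

variable {F G : Type*} [NormedAddCommGroup F] [InnerProductSpace ℝ F]
  [NormedAddCommGroup G] [InnerProductSpace ℝ G]

/-- The homeomorphism of unit spheres induced by a linear isometry equivalence. -/
def sphereHomeomorph (e : F ≃ₗᵢ[ℝ] G) : Metric.sphere (0 : F) 1 ≃ₜ Metric.sphere (0 : G) 1 where
  toFun s := ⟨e s, by have := norm_eq_of_mem_sphere s; simp [this]⟩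
  invFun s := ⟨e.symm s, by have := norm_eq_of_mem_sphere s; simp [this]⟩
  left_inv s := by simp
  right_inv s := by simp
  continuous_toFun := by fun_prop
  continuous_invFun := by fun_prop

@[simp] theorem coe_sphereHomeomorph (e : F ≃ₗᵢ[ℝ] G) (s : Metric.sphere (0 : F) 1) :
    (sphereHomeomorph e s : G) = e s := rfl

variable [FiniteDimensional ℝ F] [MeasurableSpace F] [BorelSpace F]
  [FiniteDimensional ℝ G] [MeasurableSpace G] [BorelSpace G]

instance : IsFiniteMeasure (surfaceMeasure F) := by
  unfold surfaceMeasure; infer_instance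

/-- The surface measure of a set is the dimension times the volume of the cone over it; a linear
isometry maps cones to cones and preserves volume. -/
theorem measurePreserving_sphereHomeomorph (e : F ≃ₗᵢ[ℝ] G) :
    MeasurePreserving (sphereHomeomorph e) (surfaceMeasure F) (surfaceMeasure G) := by
  refine ⟨(sphereHomeomorph e).measurable, ?_⟩
  ext s hs
  rw [Measure.map_apply (sphereHomeomorph e).measurable hs, surfaceMeasure, surfaceMeasure,
    Measure.toSphere_apply' _ hs,
    Measure.toSphere_apply' _ ((sphereHomeomorph e).measurable hs),
    e.toLinearEquiv.finrank_eq]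
  congr 1
  rw [← e.measurePreserving.measure_preimage_emb e.toHomeomorph.measurableEmbedding]
  congr 1
  ext v
  simp only [Set.mem_smul, Set.mem_image, Set.mem_preimage]
  constructor
  · rintro ⟨r, hr, _, ⟨u, hu, rfl⟩, rfl⟩
    exact ⟨r, hr, _, ⟨_, hu, rfl⟩, by simp⟩
  · rintro ⟨r, hr, _, ⟨u, hu, rfl⟩, h⟩
    refine ⟨r, hr, _, ⟨(sphereHomeomorph e).symm u, by simpa using hu, rfl⟩, ?_⟩
    apply e.injective
    rw [← h, map_smul]
    congr 1
    exact e.apply_symm_apply u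

theorem integral_sphereHomeomorph (e : F ≃ₗᵢ[ℝ] G) (f : Metric.sphere (0 : G) 1 → ℂ) :
    ∫ s, f (sphereHomeomorph e s) ∂surfaceMeasure F = ∫ s, f s ∂surfaceMeasure G :=
  (measurePreserving_sphereHomeomorph e).integral_comp
    (sphereHomeomorph e).measurableEmbedding f

theorem sphereArea_pos {d : ℝ} (hd : 0 < d) : 0 < sphereArea d := by
  have := Real.Gamma_pos_of_pos (half_pos hd)
  unfold sphereArea
  positivity

theorem surfaceMeasure_real_univ [Nontrivial F] :
    (surfaceMeasure F).real Set.univ = sphereArea (Module.finrank ℝ F) := by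
  have hd : (0 : ℝ) < Module.finrank ℝ F := by exact_mod_cast Module.finrank_pos
  rw [surfaceMeasure, Measure.toSphere_real_apply_univ, measureReal_def,
    InnerProductSpace.volume_ball, sphereArea, Real.Gamma_add_one (by positivity)]
  have hG := Real.Gamma_pos_of_pos (half_pos hd)
  rw [ENNReal.ofReal_one, one_pow, one_mul, ENNReal.toReal_ofReal (by positivity)]
  have : √Real.pi ^ Module.finrank ℝ F = Real.pi ^ ((Module.finrank ℝ F : ℝ) / 2) := by
    rw [Real.sqrt_eq_rpow, ← Real.rpow_natCast, ← Real.rpow_mul Real.pi_pos.le]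
    congr 1; ring
  rw [this]
  field_simp

end SphereMeasure

/-! ### The invariant mean over orthonormal pairs -/

section Frames

variable {m : ℕ}

/-- The Stiefel manifold of orthonormal pairs `(t, s)` in `ℝ^m`. -/
def Frame (m : ℕ) : Type :=
  {p : EuclideanSpace ℝ (Fin m) × EuclideanSpace ℝ (Fin m) //
    ‖p.1‖ = 1 ∧ ‖p.2‖ = 1 ∧ inner ℝ p.1 p.2 = 0}

instance : TopologicalSpace (Frame m) := instTopologicalSpaceSubtype

instance : CompactSpace (Frame m) := by
  refine isCompact_iff_compactSpace.1 (Metric.isCompact_of_isClosed_isBounded ?_ ?_)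
  · exact (isClosed_eq (by fun_prop) (by fun_prop)).inter
      ((isClosed_eq (by fun_prop) (by fun_prop)).inter (isClosed_eq (by fun_prop) (by fun_prop)))
  · refine Metric.isBounded_closedBall.subset (t := Metric.closedBall 0 1) fun p hp => ?_
    rw [mem_closedBall_zero_iff, Prod.norm_def]
    exact max_le hp.1.le hp.2.1.le

/-- The hyperplane orthogonal to `t`. -/
noncomputable abbrev perp (t : EuclideanSpace ℝ (Fin m)) : Submodule ℝ (EuclideanSpace ℝ (Fin m)) :=
  (ℝ ∙ t)ᗮ

/-- The frame `(t, s)` with `t` in the unit sphere and `s` in the unit sphere of `t^⊥`. -/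
noncomputable def Frame.mk (t : Metric.sphere (0 : EuclideanSpace ℝ (Fin m)) 1)
    (s : Metric.sphere (0 : perp (t : EuclideanSpace ℝ (Fin m))) 1) : Frame m :=
  ⟨(t, (s : perp (t : EuclideanSpace ℝ (Fin m)))), norm_eq_of_mem_sphere t,
    norm_eq_of_mem_sphere s, Submodule.mem_orthogonal_singleton_iff_inner_right.1 s.1.2⟩

/-- A linear isometry maps frames to frames. -/
noncomputable def Frame.map (g : EuclideanSpace ℝ (Fin m) ≃ₗᵢ[ℝ] EuclideanSpace ℝ (Fin m)) (p : Frame m) :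
    Frame m :=
  ⟨(g p.1.1, g p.1.2), by simpa using p.2⟩

/-- The isometry `t^⊥ ≃ (g t)^⊥` induced by a linear isometry `g`. -/
noncomputable def perpEquiv (g : EuclideanSpace ℝ (Fin m) ≃ₗᵢ[ℝ] EuclideanSpace ℝ (Fin m))
    (t t' : EuclideanSpace ℝ (Fin m)) (h : g t = t') : perp t ≃ₗᵢ[ℝ] perp t' where
  toLinearEquiv := g.toLinearEquiv.ofSubmodules (perp t) (perp t') (by
    ext v
    simp only [Submodule.mem_map, Submodule.mem_orthogonal_singleton_iff_inner_right]
    constructor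
    · rintro ⟨w, hw, rfl⟩
      rw [← h, ← hw]
      exact g.inner_map_map t w
    · intro hv
      refine ⟨g.symm v, ?_, g.apply_symm_apply v⟩
      rw [← hv, ← h, ← g.inner_map_map t, g.apply_symm_apply])
  norm_map' v := g.norm_map v

/-- The integral over the unit sphere of `t^⊥`. -/
noncomputable def fiberIntegral (f : Frame m → ℂ)
    (t : Metric.sphere (0 : EuclideanSpace ℝ (Fin m)) 1) : ℂ :=
  ∫ s, f (Frame.mk t s) ∂surfaceMeasure (perp (t : EuclideanSpace ℝ (Fin m)))

/-- The normalized iterated integral over all frames. -/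
noncomputable def frameMean (f : Frame m → ℂ) : ℂ :=
  1 / ((sphereArea m : ℂ) * (sphereArea ((m : ℝ) - 1) : ℂ)) *
    ∫ t, fiberIntegral f t ∂surfaceMeasure (EuclideanSpace ℝ (Fin m))

theorem dualRadon_eq_frameMean (F : (Fin m → ℂ) → ℂ) :
    dualRadon F = frameMean (fun p : Frame m => F (tau p.1.1 p.1.2)) := rfl

theorem fiberIntegral_sphereHomeomorph
    (g : EuclideanSpace ℝ (Fin m) ≃ₗᵢ[ℝ] EuclideanSpace ℝ (Fin m)) (f : Frame m → ℂ)
    (t : Metric.sphere (0 : EuclideanSpace ℝ (Fin m)) 1) :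
    fiberIntegral f (sphereHomeomorph g t) = fiberIntegral (fun p => f (p.map g)) t := by
  unfold fiberIntegral
  rw [← integral_sphereHomeomorph (perpEquiv g t (sphereHomeomorph g t) rfl)]
  rfl

/-- An isometry g carries the unit sphere of t^⊥ to that of (g t)^⊥, so invariance of the fibre
measures and then of the outer measure gives invariance of the mean. -/
theorem frameMean_map (g : EuclideanSpace ℝ (Fin m) ≃ₗᵢ[ℝ] EuclideanSpace ℝ (Fin m))
    (f : Frame m → ℂ) : frameMean (fun p => f (p.map g)) = frameMean f := by
  unfold frameMean
  rw [← integral_sphereHomeomorph g (fun t => fiberIntegral f t)]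
  simp only [fiberIntegral_sphereHomeomorph]

theorem continuous_frame_mk (t : Metric.sphere (0 : EuclideanSpace ℝ (Fin m)) 1) :
    Continuous (Frame.mk t) :=
  Continuous.subtype_mk (by fun_prop) _

theorem integrable_fiber (f : C(Frame m, ℂ)) (t : Metric.sphere (0 : EuclideanSpace ℝ (Fin m)) 1) :
    Integrable (fun s => f (Frame.mk t s))
      (surfaceMeasure (perp (t : EuclideanSpace ℝ (Fin m)))) :=
  .of_bound (f.continuous.comp (continuous_frame_mk t)).aestronglyMeasurable ‖f‖
    (ae_of_all _ fun _ => f.norm_coe_le_norm _)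

theorem fiberIntegral_add (f g : C(Frame m, ℂ))
    (t : Metric.sphere (0 : EuclideanSpace ℝ (Fin m)) 1) :
    fiberIntegral (f + g : C(Frame m, ℂ)) t = fiberIntegral f t + fiberIntegral g t :=
  integral_add (integrable_fiber f t) (integrable_fiber g t)

theorem fiberIntegral_smul (c : ℂ) (f : C(Frame m, ℂ))
    (t : Metric.sphere (0 : EuclideanSpace ℝ (Fin m)) 1) :
    fiberIntegral (c • f : C(Frame m, ℂ)) t = c * fiberIntegral f t :=
  integral_const_mul c _

/-- The reflection of `ℝ^m` exchanging two points of the unit sphere. -/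
noncomputable def swapReflection (e t : EuclideanSpace ℝ (Fin m)) :
    EuclideanSpace ℝ (Fin m) ≃ₗᵢ[ℝ] EuclideanSpace ℝ (Fin m) :=
  (perp (e - t)).reflection

theorem continuousOn_swapReflection (e v : EuclideanSpace ℝ (Fin m)) :
    ContinuousOn (fun t => swapReflection e t v) {e}ᶜ := by
  have : ∀ t, swapReflection e t v =
      v - (2 : ℕ) • ((inner ℝ (e - t) v / (‖e - t‖ ^ 2)) • (e - t)) := by
    intro t
    rw [swapReflection, Submodule.reflection_orthogonal_apply,
      Submodule.reflection_singleton_apply]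
    simp
  simp only [this]
  have hne : ∀ t ∈ ({e}ᶜ : Set (EuclideanSpace ℝ (Fin m))), ‖e - t‖ ^ 2 ≠ 0 := by
    intro t ht
    have : e - t ≠ 0 := sub_ne_zero.2 (Ne.symm ht)
    simpa using this
  fun_prop (disch := assumption)

theorem sphereHomeomorph_swapReflection (e t : Metric.sphere (0 : EuclideanSpace ℝ (Fin m)) 1) :
    sphereHomeomorph (swapReflection (e : EuclideanSpace ℝ (Fin m)) t) e = t :=
  Subtype.ext (Submodule.reflection_sub
    ((norm_eq_of_mem_sphere e).trans (norm_eq_of_mem_sphere t).symm))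

/-- The fibres live in different spaces t^⊥. Transport by the reflection exchanging e and t turns
them into integrals over one fixed sphere, where dependence on t can be studied. -/
theorem fiberIntegral_eq_base (f : Frame m → ℂ)
    (e t : Metric.sphere (0 : EuclideanSpace ℝ (Fin m)) 1) :
    fiberIntegral f t =
      ∫ s, f ((Frame.mk e s).map (swapReflection (e : EuclideanSpace ℝ (Fin m)) t))
        ∂surfaceMeasure (perp (e : EuclideanSpace ℝ (Fin m))) := by
  conv_lhs => rw [← sphereHomeomorph_swapReflection e t]
  rw [fiberIntegral_sphereHomeomorph]
  rfl

theorem continuous_frame_map (g : EuclideanSpace ℝ (Fin m) ≃ₗᵢ[ℝ] EuclideanSpace ℝ (Fin m)) :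
    Continuous (Frame.map g) := by
  refine Continuous.subtype_mk ?_ _
  have h : Continuous (fun p : Frame m => p.1) := continuous_subtype_val
  fun_prop

theorem integrable_fiberIntegral (hm : 1 ≤ m) (f : C(Frame m, ℂ)) :
    Integrable (fiberIntegral f) (surfaceMeasure (EuclideanSpace ℝ (Fin m))) := by
  let e : Metric.sphere (0 : EuclideanSpace ℝ (Fin m)) 1 :=
    ⟨EuclideanSpace.single ⟨0, hm⟩ 1, by simp⟩
  have hbase := fiberIntegral_eq_base f e
  refine .of_bound (C := ‖f‖ *
    (surfaceMeasure (perp (e : EuclideanSpace ℝ (Fin m)))).real Set.univ) ?_ (ae_of_all _ fun t => ?_)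
  -- The reflection depends continuously on t only for t ≠ e; continuity off a single point is
  -- enough for measurability.
  · refine Measurable.aestronglyMeasurable (measurable_of_continuousOn_compl_singleton e ?_)
    simp only [funext hbase]
    refine continuousOn_of_dominated (bound := fun _ => ‖f‖) (fun t _ => ?_)
      (fun t _ => ae_of_all _ fun s => f.norm_coe_le_norm _) (integrable_const _)
      (ae_of_all _ fun s => ?_)
    · exact (f.continuous.comp ((continuous_frame_map _).comp
        (continuous_frame_mk e))).aestronglyMeasurable
    · refine f.continuous.comp_continuousOn ?_
      have hi : Topology.IsInducing (fun p : Frame m => p.1) := ⟨rfl⟩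
      rw [hi.continuousOn_iff]
      have h : ∀ v, ContinuousOn (fun t : Metric.sphere (0 : EuclideanSpace ℝ (Fin m)) 1 =>
          swapReflection (e : EuclideanSpace ℝ (Fin m)) t v) {e}ᶜ := fun v =>
        (continuousOn_swapReflection (e : EuclideanSpace ℝ (Fin m)) v).comp
          continuous_subtype_val.continuousOn fun t ht h => ht (Subtype.ext h)
      exact (h _).prodMk (h _)
  · rw [hbase t]
    exact norm_integral_le_of_norm_le_const (ae_of_all _ fun s => f.norm_coe_le_norm _)

/-- The normalized integral over all frames as a linear functional on continuous functions. -/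
noncomputable def frameMeanLM (hm : 1 ≤ m) : C(Frame m, ℂ) →ₗ[ℂ] ℂ where
  toFun f := frameMean f
  map_add' f g := by
    unfold frameMean
    rw [← mul_add, ← integral_add (integrable_fiberIntegral hm f) (integrable_fiberIntegral hm g)]
    simp only [fiberIntegral_add]
  map_smul' c f := by
    unfold frameMean
    simp only [fiberIntegral_smul, integral_const_mul, RingHom.id_apply, smul_eq_mul]
    ring

theorem frameMean_one (hm : 2 ≤ m) : frameMean (fun _ : Frame m => 1) = 1 := by
  have hnt : Nontrivial (EuclideanSpace ℝ (Fin m)) :=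
    Module.nontrivial_of_finrank_pos (R := ℝ) (by rw [finrank_euclideanSpace_fin]; omega)
  have hfr : ∀ t : Metric.sphere (0 : EuclideanSpace ℝ (Fin m)) 1,
      Module.finrank ℝ (perp (t : EuclideanSpace ℝ (Fin m))) = m - 1 := by
    intro t
    have : Fact (Module.finrank ℝ (EuclideanSpace ℝ (Fin m)) = (m - 1) + 1) :=
      ⟨by rw [finrank_euclideanSpace_fin]; omega⟩
    exact Submodule.finrank_orthogonal_span_singleton (ne_zero_of_mem_unit_sphere t)
  have hf : ∀ t, fiberIntegral (fun _ : Frame m => 1) t = sphereArea ((m : ℝ) - 1) := by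
    intro t
    have hnt' : Nontrivial (perp (t : EuclideanSpace ℝ (Fin m))) :=
      Module.nontrivial_of_finrank_pos (R := ℝ) (by rw [hfr]; omega)
    rw [fiberIntegral, integral_const, surfaceMeasure_real_univ, hfr, Nat.cast_sub (by omega)]
    simp
  have hm' : (2 : ℝ) ≤ m := by exact_mod_cast hm
  have h1 : (sphereArea m : ℂ) ≠ 0 := by
    exact_mod_cast (sphereArea_pos (by linarith : (0 : ℝ) < m)).ne'
  have h2 : (sphereArea ((m : ℝ) - 1) : ℂ) ≠ 0 := by
    exact_mod_cast (sphereArea_pos (by linarith : (0 : ℝ) < (m : ℝ) - 1)).ne'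
  simp only [frameMean, hf, integral_const, surfaceMeasure_real_univ, finrank_euclideanSpace_fin]
  rw [Complex.real_smul]
  field_simp

end Frames
end HuaRadon

namespace HuaRadon
open MvPolynomial

/-! ### Applying a linear functional to coefficients -/

section CoefficientMap

variable {σ S : Type*} [CommRing S] [Algebra ℂ S]

/-- The map on polynomials applying a linear functional to each coefficient. -/
noncomputable def mapCoeff (φ : S →ₗ[ℂ] ℂ) : MvPolynomial σ S →+ MvPolynomial σ ℂ where
  toFun f := AddMonoidAlgebra.map φ.toAddMonoidHom f
  map_zero' := by ext s; exact map_zero φ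
  map_add' f g := by ext s; exact map_add φ (coeff s f) (coeff s g)

@[simp] theorem coeff_mapCoeff (φ : S →ₗ[ℂ] ℂ) (f : MvPolynomial σ S) (s : σ →₀ ℕ) :
    coeff s (mapCoeff φ f) = φ (coeff s f) := rfl

/-- This replaces differentiation under the integral sign: a formal derivative multiplies
coefficients by integers, which any linear functional respects. -/
theorem mapCoeff_pderiv (φ : S →ₗ[ℂ] ℂ) (i : σ) (f : MvPolynomial σ S) :
    mapCoeff φ (pderiv i f) = pderiv i (mapCoeff φ f) := by
  ext s
  rw [coeff_mapCoeff, coeff_pderiv, coeff_pderiv, coeff_mapCoeff]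
  have : ((s i : S) + 1) = ((s i + 1 : ℕ) : S) := by push_cast; rfl
  rw [this, mul_comm, ← nsmul_eq_mul, map_nsmul, nsmul_eq_mul, mul_comm]
  push_cast
  rfl

theorem mapCoeff_mixedLaplacian {m : ℕ} (φ : S →ₗ[ℂ] ℂ) (a b : Fin m → σ)
    (f : MvPolynomial σ S) :
    mapCoeff φ (mixedLaplacian a b f) = mixedLaplacian a b (mapCoeff φ f) := by
  simp only [mixedLaplacian_apply, map_sum, mapCoeff_pderiv]

theorem mapCoeff_monomial (φ : S →ₗ[ℂ] ℂ) (s : σ →₀ ℕ) (c : S) :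
    mapCoeff φ (monomial s c) = monomial s (φ c) := by
  classical
  ext s'
  rw [coeff_mapCoeff, coeff_monomial, coeff_monomial]
  split_ifs <;> simp

theorem eval_mapCoeff (φ : S →ₗ[ℂ] ℂ) (a : σ → ℂ) (f : MvPolynomial σ S) :
    eval a (mapCoeff φ f) = φ (eval (fun i => algebraMap ℂ S (a i)) f) := by
  induction f using MvPolynomial.induction_on' with
  | add p q hp hq => simp [hp, hq]
  | monomial s c =>
    rw [mapCoeff_monomial, eval_monomial, eval_monomial]
    have : (s.prod fun n e => algebraMap ℂ S (a n) ^ e) =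
        algebraMap ℂ S (s.prod fun n e => a n ^ e) := by
      simp [Finsupp.prod]
    rw [this, mul_comm c, ← Algebra.smul_def, map_smul, smul_eq_mul, mul_comm]

end CoefficientMap

/-! ### The operators on products of isotropic linear forms -/

section LinearForms

variable {m : ℕ} {S : Type*} [CommRing S]

/-- The polynomial `⟨x, v⟩` in the variables `(x, y)`. -/
noncomputable def linX (v : Fin m → S) : MvPolynomial (Fin m ⊕ Fin m) S :=
  ∑ i, C (v i) * X (Sum.inl i)

/-- The polynomial `⟨y, v⟩` in the variables `(x, y)`. -/
noncomputable def linY (v : Fin m → S) : MvPolynomial (Fin m ⊕ Fin m) S :=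
  ∑ i, C (v i) * X (Sum.inr i)

@[simp] theorem pderiv_inl_linX (v : Fin m → S) (i : Fin m) :
    pderiv (Sum.inl i) (linX v) = C (v i) := by
  simp [linX, pderiv_X, Pi.single_apply]

@[simp] theorem pderiv_inr_linX (v : Fin m → S) (i : Fin m) :
    pderiv (Sum.inr i) (linX v) = 0 := by
  simp [linX, pderiv_X]

@[simp] theorem pderiv_inl_linY (v : Fin m → S) (i : Fin m) :
    pderiv (Sum.inl i) (linY v) = 0 := by
  simp [linY, pderiv_X]

@[simp] theorem pderiv_inr_linY (v : Fin m → S) (i : Fin m) :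
    pderiv (Sum.inr i) (linY v) = C (v i) := by
  simp [linY, pderiv_X, Pi.single_apply]

/-- Isotropy of v and w kills the terms where both derivatives hit the same form; the cross term
carries 2ab⟨v,w⟩ = -4ab. -/
theorem mixedLaplacian_inl_inl_linear {v w : Fin m → S} (hv : ∑ i, v i ^ 2 = 0)
    (hw : ∑ i, w i ^ 2 = 0) (hvw : ∑ i, v i * w i = -2) (a b c d : ℕ) :
    mixedLaplacian Sum.inl Sum.inl (linX v ^ a * linX w ^ b * linY v ^ c * linY w ^ d) =
      -((4 * a * b : ℕ) : MvPolynomial (Fin m ⊕ Fin m) S) *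
        (linX v ^ (a - 1) * linX w ^ (b - 1) * linY v ^ c * linY w ^ d) := by
  set z := linX v with hz
  set z' := linY v with hz'
  set u := linX w with hu
  set u' := linY w with hu'
  set V : Fin m → MvPolynomial (Fin m ⊕ Fin m) S := fun i => C (v i) with hV
  set W : Fin m → MvPolynomial (Fin m ⊕ Fin m) S := fun i => C (w i) with hW
  have h1 : ∀ i : Fin m, pderiv (Sum.inl i) (pderiv (Sum.inl i) (z ^ a * u ^ b * z' ^ c * u' ^ d)) =
      a * ((a - 1 : ℕ) : MvPolynomial (Fin m ⊕ Fin m) S) * z ^ (a - 1 - 1) * u ^ b * z' ^ c *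
          u' ^ d * V i ^ 2 +
        2 * a * b * z ^ (a - 1) * u ^ (b - 1) * z' ^ c * u' ^ d * (V i * W i) +
        b * ((b - 1 : ℕ) : MvPolynomial (Fin m ⊕ Fin m) S) * u ^ (b - 1 - 1) * z ^ a * z' ^ c *
          u' ^ d * W i ^ 2 := by
    intro i
    simp only [hz, hz', hu, hu', hV, hW, pderiv_mul, pderiv_pow, map_add, pderiv_inl_linX,
      pderiv_inl_linY, Derivation.map_natCast, map_zero, pderiv_C]
    ring
  rw [mixedLaplacian_apply, Finset.sum_congr rfl fun i _ => h1 i]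
  simp only [Finset.sum_add_distrib, ← Finset.mul_sum]
  have e1 : ∑ i, V i ^ 2 = 0 := by simp only [hV, ← map_pow, ← map_sum, hv, map_zero]
  have e2 : ∑ i, V i * W i = -2 := by
    simp only [hV, hW, ← map_mul, ← map_sum, hvw, map_neg, map_ofNat]
  have e3 : ∑ i, W i ^ 2 = 0 := by simp only [hW, ← map_pow, ← map_sum, hw, map_zero]
  rw [e1, e2, e3]
  push_cast
  ring

theorem mixedLaplacian_inr_inr_linear {v w : Fin m → S} (hv : ∑ i, v i ^ 2 = 0)
    (hw : ∑ i, w i ^ 2 = 0) (hvw : ∑ i, v i * w i = -2) (a b c d : ℕ) :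
    mixedLaplacian Sum.inr Sum.inr (linX v ^ a * linX w ^ b * linY v ^ c * linY w ^ d) =
      -((4 * c * d : ℕ) : MvPolynomial (Fin m ⊕ Fin m) S) *
        (linX v ^ a * linX w ^ b * linY v ^ (c - 1) * linY w ^ (d - 1)) := by
  have hX : ∀ v : Fin m → S, rename Sum.swap (linX v) = linY v := by simp [linX, linY]
  have hY : ∀ v : Fin m → S, rename Sum.swap (linY v) = linX v := by simp [linX, linY]
  have h := mixedLaplacian_inl_inl_linear hv hw hvw c d a b
  apply_fun rename Sum.swap at h
  rw [← mixedLaplacian_inr_inr_rename_swap] at h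
  simp only [map_mul, map_pow, hX, hY, map_neg, map_natCast] at h
  convert h using 2 <;> ring

theorem mixedLaplacian_inl_inr_linear {v w : Fin m → S} (hv : ∑ i, v i ^ 2 = 0)
    (hw : ∑ i, w i ^ 2 = 0) (hvw : ∑ i, v i * w i = -2) (a b c d : ℕ) :
    mixedLaplacian Sum.inl Sum.inr (linX v ^ a * linX w ^ b * linY v ^ c * linY w ^ d) =
      -((2 * a * d : ℕ) : MvPolynomial (Fin m ⊕ Fin m) S) *
        (linX v ^ (a - 1) * linX w ^ b * linY v ^ c * linY w ^ (d - 1)) -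
      ((2 * b * c : ℕ) : MvPolynomial (Fin m ⊕ Fin m) S) *
        (linX v ^ a * linX w ^ (b - 1) * linY v ^ (c - 1) * linY w ^ d) := by
  set z := linX v with hz
  set z' := linY v with hz'
  set u := linX w with hu
  set u' := linY w with hu'
  set V : Fin m → MvPolynomial (Fin m ⊕ Fin m) S := fun i => C (v i) with hV
  set W : Fin m → MvPolynomial (Fin m ⊕ Fin m) S := fun i => C (w i) with hW
  have h1 : ∀ i : Fin m, pderiv (Sum.inl i) (pderiv (Sum.inr i) (z ^ a * u ^ b * z' ^ c * u' ^ d)) =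
      a * c * z ^ (a - 1) * u ^ b * z' ^ (c - 1) * u' ^ d * V i ^ 2 +
        (a * d * z ^ (a - 1) * u ^ b * z' ^ c * u' ^ (d - 1) +
          b * c * z ^ a * u ^ (b - 1) * z' ^ (c - 1) * u' ^ d) * (V i * W i) +
        b * d * z ^ a * u ^ (b - 1) * z' ^ c * u' ^ (d - 1) * W i ^ 2 := by
    intro i
    simp only [hz, hz', hu, hu', hV, hW, pderiv_mul, pderiv_pow, map_add, pderiv_inl_linX,
      pderiv_inl_linY, pderiv_inr_linX, pderiv_inr_linY, Derivation.map_natCast, map_zero, pderiv_C]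
    ring
  rw [mixedLaplacian_apply, Finset.sum_congr rfl fun i _ => h1 i]
  simp only [Finset.sum_add_distrib, ← Finset.mul_sum]
  have e1 : ∑ i, V i ^ 2 = 0 := by simp only [hV, ← map_pow, ← map_sum, hv, map_zero]
  have e2 : ∑ i, V i * W i = -2 := by
    simp only [hV, hW, ← map_mul, ← map_sum, hvw, map_neg, map_ofNat]
  have e3 : ∑ i, W i ^ 2 = 0 := by simp only [hW, ← map_pow, ← map_sum, hw, map_zero]
  rw [e1, e2, e3]
  push_cast
  ring

end LinearForms

/-! ### The kernel as a polynomial and its differential recursions -/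

section RadonPolynomial

variable {m : ℕ}

/-- The coordinates of `τ = t + i s` as continuous functions of the frame `(t, s)`. -/
noncomputable def tauCoord (i : Fin m) : C(Frame m, ℂ) where
  toFun p := tau p.1.1 p.1.2 i
  continuous_toFun := by
    have h : Continuous (fun p : Frame m => p.1) := continuous_subtype_val
    unfold tau
    fun_prop

/-- The coordinates of `τ†` as continuous functions of the frame `(t, s)`. -/
noncomputable def tauDaggerCoord (i : Fin m) : C(Frame m, ℂ) where
  toFun p := dagger (tau p.1.1 p.1.2) i
  continuous_toFun := by
    have h : Continuous (fun p : Frame m => p.1) := continuous_subtype_val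
    unfold tau dagger
    fun_prop

theorem Frame.sum_sq (p : Frame m) :
    ∑ i, (p.1.1 i : ℂ) ^ 2 = 1 ∧ ∑ i, (p.1.2 i : ℂ) ^ 2 = 1 ∧
      ∑ i, (p.1.1 i : ℂ) * (p.1.2 i : ℂ) = 0 := by
  obtain ⟨⟨t, s⟩, ht, hs, hts⟩ := p
  simp only at ht hs hts ⊢
  have h1 := EuclideanSpace.real_norm_sq_eq t
  have h2 := EuclideanSpace.real_norm_sq_eq s
  rw [ht, one_pow] at h1
  rw [hs, one_pow] at h2
  rw [PiLp.inner_apply] at hts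
  refine ⟨by exact_mod_cast h1.symm, by exact_mod_cast h2.symm, ?_⟩
  have : ∑ i, t i * s i = 0 := by
    rw [← hts]
    exact Finset.sum_congr rfl fun i _ => by simp [mul_comm]
  exact_mod_cast this

theorem sum_tauCoord_sq : ∑ i, (tauCoord (m := m) i) ^ 2 = 0 := by
  ext p
  obtain ⟨h1, h2, h3⟩ := p.sum_sq
  simp only [tauCoord, tau, ContinuousMap.coe_sum, ContinuousMap.coe_pow, Finset.sum_apply,
    Pi.pow_apply, ContinuousMap.coe_mk, ContinuousMap.zero_apply]
  have : ∀ i, ((p.1.1 i : ℂ) + Complex.I * p.1.2 i) ^ 2 =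
      (p.1.1 i : ℂ) ^ 2 - (p.1.2 i : ℂ) ^ 2 + 2 * Complex.I * ((p.1.1 i : ℂ) * p.1.2 i) := by
    intro i
    linear_combination (p.1.2 i : ℂ) ^ 2 * Complex.I_sq
  simp only [this, Finset.sum_add_distrib, Finset.sum_sub_distrib, ← Finset.mul_sum, h1, h2, h3]
  ring

theorem sum_tauDaggerCoord_sq : ∑ i, (tauDaggerCoord (m := m) i) ^ 2 = 0 := by
  ext p
  obtain ⟨h1, h2, h3⟩ := p.sum_sq
  simp only [tauDaggerCoord, dagger_tau, ContinuousMap.coe_sum, ContinuousMap.coe_pow,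
    Finset.sum_apply, Pi.pow_apply, ContinuousMap.coe_mk, ContinuousMap.zero_apply]
  have : ∀ i, (-(p.1.1 i : ℂ) + Complex.I * p.1.2 i) ^ 2 =
      (p.1.1 i : ℂ) ^ 2 - (p.1.2 i : ℂ) ^ 2 - 2 * Complex.I * ((p.1.1 i : ℂ) * p.1.2 i) := by
    intro i
    linear_combination (p.1.2 i : ℂ) ^ 2 * Complex.I_sq
  simp only [this, Finset.sum_sub_distrib, ← Finset.mul_sum, h1, h2, h3]
  ring

theorem sum_tauCoord_mul_tauDaggerCoord :
    ∑ i, tauCoord (m := m) i * tauDaggerCoord i = -2 := by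
  ext p
  obtain ⟨h1, h2, h3⟩ := p.sum_sq
  have h4 : (-2 : C(Frame m, ℂ)) p = -2 := rfl
  rw [h4]
  simp only [tauCoord, tauDaggerCoord, dagger_tau, tau, ContinuousMap.coe_sum, ContinuousMap.coe_mul,
    Finset.sum_apply, Pi.mul_apply, ContinuousMap.coe_mk]
  have : ∀ i, ((p.1.1 i : ℂ) + Complex.I * p.1.2 i) * (-(p.1.1 i : ℂ) + Complex.I * p.1.2 i) =
      -(p.1.1 i : ℂ) ^ 2 - (p.1.2 i : ℂ) ^ 2 := by
    intro i
    linear_combination (p.1.2 i : ℂ) ^ 2 * Complex.I_sq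
  simp only [this, Finset.sum_sub_distrib, Finset.sum_neg_distrib, h1, h2]
  ring

/-- The polynomial `L_{k,l}` in the variables `(x, y)`. -/
noncomputable def radonPoly (hm : 1 ≤ m) (k l : ℕ) : MvPolynomial (Fin m ⊕ Fin m) ℂ :=
  mapCoeff (frameMeanLM hm) (linX tauCoord ^ k * linX tauDaggerCoord ^ l *
    linY tauCoord ^ l * linY tauDaggerCoord ^ k)

theorem mapCoeff_natCast_mul {σ S : Type*} [CommRing S] [Algebra ℂ S] (φ : S →ₗ[ℂ] ℂ) (n : ℕ)
    (f : MvPolynomial σ S) :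
    mapCoeff φ ((n : MvPolynomial σ S) * f) = (n : MvPolynomial σ ℂ) * mapCoeff φ f := by
  rw [← nsmul_eq_mul, map_nsmul, nsmul_eq_mul]

/-- Δ_x and Δ_y each contribute -4kl, and together they lower all four exponents by one, so the
family of kernels is closed under Δ_x Δ_y. -/
theorem mixedLaplacian_radonPoly_iterate (hm : 1 ≤ m) (k l : ℕ) :
    mixedLaplacian Sum.inr Sum.inr (mixedLaplacian Sum.inl Sum.inl (radonPoly hm k l)) =
      ((16 * k ^ 2 * l ^ 2 : ℕ) : MvPolynomial (Fin m ⊕ Fin m) ℂ) *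
        radonPoly hm (k - 1) (l - 1) := by
  rw [radonPoly, ← mapCoeff_mixedLaplacian, ← mapCoeff_mixedLaplacian,
    mixedLaplacian_inl_inl_linear sum_tauCoord_sq sum_tauDaggerCoord_sq
      sum_tauCoord_mul_tauDaggerCoord, neg_mul, map_neg, ← nsmul_eq_mul, map_nsmul,
    mixedLaplacian_inr_inr_linear sum_tauCoord_sq sum_tauDaggerCoord_sq
      sum_tauCoord_mul_tauDaggerCoord, neg_mul, smul_neg, neg_neg, nsmul_eq_mul, ← mul_assoc,
    ← Nat.cast_mul, mapCoeff_natCast_mul, radonPoly]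
  congr 2
  ring

/-- Only ⟨x,τ⟩ against ⟨y,τ†⟩ (both exponents k) and ⟨x,τ†⟩ against ⟨y,τ⟩ (both exponents l)
interact. -/
theorem mixedLaplacian_inl_inr_radonPoly (hm : 1 ≤ m) (k l : ℕ) :
    mixedLaplacian Sum.inl Sum.inr (radonPoly hm k l) =
      -((2 * k ^ 2 : ℕ) : MvPolynomial (Fin m ⊕ Fin m) ℂ) * radonPoly hm (k - 1) l -
        ((2 * l ^ 2 : ℕ) : MvPolynomial (Fin m ⊕ Fin m) ℂ) * radonPoly hm k (l - 1) := by
  rw [radonPoly, ← mapCoeff_mixedLaplacian,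
    mixedLaplacian_inl_inr_linear sum_tauCoord_sq sum_tauDaggerCoord_sq
      sum_tauCoord_mul_tauDaggerCoord, map_sub, neg_mul, map_neg, mapCoeff_natCast_mul,
      mapCoeff_natCast_mul, radonPoly, radonPoly, neg_mul,
    show 2 * k ^ 2 = 2 * k * k by ring, show 2 * l ^ 2 = 2 * l * l by ring]

theorem radonPoly_zero_zero (hm : 2 ≤ m) : radonPoly (by omega : 1 ≤ m) 0 0 = 1 := by
  have h : frameMeanLM (by omega : 1 ≤ m) 1 = 1 := frameMean_one hm
  have h1 : (1 : MvPolynomial (Fin m ⊕ Fin m) C(Frame m, ℂ)) = monomial 0 1 := rfl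
  simp only [radonPoly, pow_zero, mul_one]
  rw [h1, mapCoeff_monomial, h]
  rfl

/-- The kernel `L_{k,l}(x, y)`. -/
noncomputable def radonKernel (k l : ℕ) (x y : EuclideanSpace ℝ (Fin m)) : ℂ :=
  dualRadon (fun τ : Fin m → ℂ =>
    pairing x τ ^ k * pairing x (dagger τ) ^ l * (pairing y τ ^ l * pairing y (dagger τ) ^ k))

/-- The point of `ℂ^m × ℂ^m` given by two real vectors. -/
noncomputable def realPoint (x y : EuclideanSpace ℝ (Fin m)) : Fin m ⊕ Fin m → ℂ :=
  Sum.elim (fun i => (x i : ℂ)) (fun i => (y i : ℂ))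

theorem eval_linX_apply (x y : EuclideanSpace ℝ (Fin m)) (v : Fin m → C(Frame m, ℂ))
    (p : Frame m) :
    eval (fun i => algebraMap ℂ C(Frame m, ℂ) (realPoint x y i)) (linX v) p =
      pairing x (fun i => v i p) := by
  simp only [linX, map_sum, map_mul, eval_C, eval_X, pairing, ContinuousMap.coe_sum,
    Finset.sum_apply, ContinuousMap.mul_apply]
  exact Finset.sum_congr rfl fun i _ => by simp [realPoint, mul_comm]

theorem eval_linY_apply (x y : EuclideanSpace ℝ (Fin m)) (v : Fin m → C(Frame m, ℂ))
    (p : Frame m) :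
    eval (fun i => algebraMap ℂ C(Frame m, ℂ) (realPoint x y i)) (linY v) p =
      pairing y (fun i => v i p) := by
  simp only [linY, map_sum, map_mul, eval_C, eval_X, pairing, ContinuousMap.coe_sum,
    Finset.sum_apply, ContinuousMap.mul_apply]
  exact Finset.sum_congr rfl fun i _ => by simp [realPoint, mul_comm]

theorem eval_radonPoly (hm : 1 ≤ m) (k l : ℕ) (x y : EuclideanSpace ℝ (Fin m)) :
    eval (realPoint x y) (radonPoly hm k l) = radonKernel k l x y := by
  rw [radonPoly, eval_mapCoeff, radonKernel, dualRadon_eq_frameMean]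
  change frameMean _ = frameMean _
  congr 1
  funext p
  simp only [map_mul, map_pow, ContinuousMap.mul_apply, ContinuousMap.pow_apply, eval_linX_apply,
    eval_linY_apply]
  exact mul_assoc _ _ _

theorem eval_normSqX (x y : EuclideanSpace ℝ (Fin m)) :
    eval (realPoint x y) (normSqX m ℂ) = (‖x‖ : ℂ) ^ 2 := by
  have h := EuclideanSpace.real_norm_sq_eq x
  simp only [normSqX, realPoint, map_sum, map_pow, eval_X, Sum.elim_inl]
  exact_mod_cast h.symm

theorem eval_normSqY (x y : EuclideanSpace ℝ (Fin m)) :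
    eval (realPoint x y) (normSqY m ℂ) = (‖y‖ : ℂ) ^ 2 := by
  have h := EuclideanSpace.real_norm_sq_eq y
  simp only [normSqY, realPoint, map_sum, map_pow, eval_X, Sum.elim_inr]
  exact_mod_cast h.symm

theorem eval_innerXY (x y : EuclideanSpace ℝ (Fin m)) :
    eval (realPoint x y) (innerXY m ℂ) = (inner ℝ x y : ℝ) := by
  simp [innerXY, realPoint, PiLp.inner_apply, mul_comm]

/-- Since ℝ is infinite, identities known for real vectors become polynomial identities and may then
be evaluated at complex points. -/
theorem ext_realPoint {f g : MvPolynomial (Fin m ⊕ Fin m) ℂ}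
    (h : ∀ x y : EuclideanSpace ℝ (Fin m), eval (realPoint x y) f = eval (realPoint x y) g) :
    f = g := by
  refine funext_set (fun _ => Set.range ((↑) : ℝ → ℂ))
    (fun _ => Set.infinite_range_of_injective Complex.ofReal_injective) fun a ha => ?_
  choose b hb using fun i => ha i (Set.mem_univ i)
  have := h (WithLp.toLp 2 fun i => b (Sum.inl i)) (WithLp.toLp 2 fun i => b (Sum.inr i))
  have hab : realPoint (WithLp.toLp 2 fun i => b (Sum.inl i))
      (WithLp.toLp 2 fun i => b (Sum.inr i)) = a := by
    funext i
    rcases i with i | i <;> simp [realPoint, hb]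
  rwa [hab] at this

end RadonPolynomial

/-! ### Isometry invariance forces a polynomial in ⟨x,y⟩ and |x|²|y|² -/

section Invariance

variable {m : ℕ}

theorem pairing_tau (x t s : EuclideanSpace ℝ (Fin m)) :
    pairing x (tau t s) = (inner ℝ x t : ℝ) + Complex.I * (inner ℝ x s : ℝ) := by
  simp only [pairing, tau, PiLp.inner_apply, mul_add, Finset.sum_add_distrib, Complex.ofReal_sum,
    Finset.mul_sum]
  congr 1 <;> refine Finset.sum_congr rfl fun i _ => ?_
  · simp [mul_comm]
  · simp; ring

theorem pairing_dagger_tau (x t s : EuclideanSpace ℝ (Fin m)) :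
    pairing x (dagger (tau t s)) = -(inner ℝ x t : ℝ) + Complex.I * (inner ℝ x s : ℝ) := by
  simp only [pairing, dagger_tau, PiLp.inner_apply, mul_add, Finset.sum_add_distrib,
    Complex.ofReal_sum, Finset.mul_sum, ← Finset.sum_neg_distrib]
  congr 1 <;> refine Finset.sum_congr rfl fun i _ => ?_
  · simp [mul_comm]
  · simp; ring

theorem radonKernel_map (k l : ℕ)
    (g : EuclideanSpace ℝ (Fin m) ≃ₗᵢ[ℝ] EuclideanSpace ℝ (Fin m))
    (x y : EuclideanSpace ℝ (Fin m)) :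
    radonKernel k l (g x) (g y) = radonKernel k l x y := by
  rw [radonKernel, radonKernel, dualRadon_eq_frameMean, dualRadon_eq_frameMean,
    ← frameMean_map g]
  simp only [Frame.map, pairing_tau, pairing_dagger_tau, g.inner_map_map]

/-- Binary forms of degree `n` with coefficients in a complex algebra, as functions on `ℂ × ℂ`. -/
def IsBinaryForm {S : Type*} [CommRing S] [Algebra ℂ S] (n : ℕ) (f : ℂ → ℂ → S) : Prop :=
  ∃ c : ℕ → S, ∀ β γ, f β γ = ∑ i ∈ Finset.range (n + 1), (β ^ (n - i) * γ ^ i) • c i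

theorem IsBinaryForm.linear_mul {S : Type*} [CommRing S] [Algebra ℂ S] {n : ℕ} {f : ℂ → ℂ → S}
    (hf : IsBinaryForm n f) (z w : S) :
    IsBinaryForm (n + 1) fun β γ => (β • z + γ • w) * f β γ := by
  obtain ⟨c, hc⟩ := hf
  refine ⟨fun i => (if i < n + 1 then z * c i else 0) + (if i = 0 then 0 else w * c (i - 1)),
    fun β γ => ?_⟩
  simp only [hc, smul_add, Finset.sum_add_distrib, add_mul]
  congr 1
  · rw [Finset.sum_range_succ _ (n + 1), if_neg (lt_irrefl _), smul_zero, add_zero, Finset.mul_sum]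
    refine Finset.sum_congr rfl fun i hi => ?_
    rw [Finset.mem_range] at hi
    rw [if_pos hi, show n + 1 - i = (n - i) + 1 by omega, smul_mul_smul_comm]
    congr 1; ring
  · rw [Finset.sum_range_succ' _ (n + 1), if_pos rfl, smul_zero, add_zero, Finset.mul_sum]
    refine Finset.sum_congr rfl fun i hi => ?_
    rw [if_neg (by omega), show n + 1 - (i + 1) = n - i by omega, smul_mul_smul_comm]
    congr 1; ring

theorem isBinaryForm_linear_pow_mul {S : Type*} [CommRing S] [Algebra ℂ S] (z w z' w' : S)
    (a b : ℕ) :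
    IsBinaryForm (a + b) fun β γ => (β • z + γ • w) ^ a * (β • z' + γ • w') ^ b := by
  induction a with
  | zero =>
    induction b with
    | zero => exact ⟨fun _ => 1, fun β γ => by simp⟩
    | succ b ih =>
      have := ih.linear_mul z' w'
      rw [zero_add] at this ⊢
      convert this using 3
      rw [pow_succ]; ring
  | succ a ih =>
    have := ih.linear_mul z w
    rw [show a + 1 + b = a + b + 1 by omega]
    convert this using 3
    rw [pow_succ]; ring

theorem IsBinaryForm.mul_left {S : Type*} [CommRing S] [Algebra ℂ S] {n : ℕ} {f : ℂ → ℂ → S}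
    (hf : IsBinaryForm n f) (a : S) : IsBinaryForm n fun β γ => a * f β γ := by
  obtain ⟨c, hc⟩ := hf
  exact ⟨fun i => a * c i, fun β γ => by simp [hc, Finset.mul_sum]⟩

theorem IsBinaryForm.map {S : Type*} [CommRing S] [Algebra ℂ S] {n : ℕ} {f : ℂ → ℂ → S}
    (hf : IsBinaryForm n f) (φ : S →ₗ[ℂ] ℂ) : IsBinaryForm n fun β γ => φ (f β γ) := by
  obtain ⟨c, hc⟩ := hf
  exact ⟨fun i => φ (c i), fun β γ => by simp [hc]⟩

theorem sum_range_even {A : Type*} [AddCommMonoid A] (n : ℕ) (f : ℕ → A)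
    (hf : ∀ i, Odd i → f i = 0) :
    ∑ i ∈ Finset.range (n + 1), f i = ∑ j ∈ Finset.range (n / 2 + 1), f (2 * j) := by
  symm
  refine Finset.sum_of_injOn (fun j => 2 * j) (fun a _ b _ h => by simpa using h) ?_ ?_
    (fun _ _ => rfl)
  · intro j hj
    simp only [Finset.coe_range, Set.mem_Iio] at hj ⊢
    omega
  · intro i hi hi'
    refine hf i (Nat.not_even_iff_odd.1 fun ⟨j, hj⟩ => hi' ⟨j, ?_, by dsimp only; omega⟩)
    simp only [Finset.mem_range, Finset.coe_range, Set.mem_Iio] at hi ⊢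
    omega

/-- Where a binary form takes equal values at `γ` and `-γ`, it agrees with its even part. -/
theorem IsBinaryForm.eq_even {n : ℕ} {f : ℂ → ℂ → ℂ} (hf : IsBinaryForm n f) :
    ∃ c : ℕ → ℂ, ∀ β γ, f β γ = f β (-γ) →
      f β γ = ∑ j ∈ Finset.range (n / 2 + 1), c j * (β ^ (n - 2 * j) * γ ^ (2 * j)) := by
  obtain ⟨c, hc⟩ := hf
  refine ⟨fun j => c (2 * j), fun β γ h => ?_⟩
  have h2 : f β γ = ∑ i ∈ Finset.range (n + 1),
      (β ^ (n - i) * (γ ^ i + (-γ) ^ i) / 2) * c i := by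
    have : f β γ = (f β γ + f β (-γ)) / 2 := by rw [← h]; ring
    rw [this, hc, hc, ← Finset.sum_add_distrib, Finset.sum_div]
    exact Finset.sum_congr rfl fun i _ => by simp only [smul_eq_mul]; ring
  rw [h2, sum_range_even]
  · refine Finset.sum_congr rfl fun j _ => ?_
    rw [(even_two_mul j).neg_pow]
    ring
  · intro i hi
    rw [hi.neg_pow]
    ring

/-- Any two vectors can be moved by an isometry into the span of the first two basis vectors. -/
theorem exists_isometry_plane {i₀ i₁ : Fin m} (h0 : (i₀ : ℕ) = 0) (h1 : (i₁ : ℕ) = 1)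
    (x y : EuclideanSpace ℝ (Fin m)) :
    ∃ (g : EuclideanSpace ℝ (Fin m) ≃ₗᵢ[ℝ] EuclideanSpace ℝ (Fin m)) (α β γ : ℝ),
      g x = α • EuclideanSpace.single i₀ 1 ∧
      g y = β • EuclideanSpace.single i₀ 1 + γ • EuclideanSpace.single i₁ 1 := by
  let f : Fin m → EuclideanSpace ℝ (Fin m) := fun i => if i = i₀ then x else if i = i₁ then y else 0
  have h01 : i₀ ≠ i₁ := fun h => by rw [h] at h0; omega
  have hcard : Module.finrank ℝ (EuclideanSpace ℝ (Fin m)) = Fintype.card (Fin m) := by simp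
  let b := InnerProductSpace.gramSchmidtOrthonormalBasis hcard f
  have hb : ∀ {i j : Fin m}, i < j → inner ℝ (b j) (f i) = 0 :=
    fun h => InnerProductSpace.gramSchmidtOrthonormalBasis_inv_triangular hcard f h
  have hx : f i₀ = x := if_pos rfl
  have hy : f i₁ = y := by simp [f, h01.symm]
  refine ⟨b.repr, b.repr x i₀, b.repr y i₀, b.repr y i₁, ?_, ?_⟩
  · ext j
    by_cases hj : j = i₀
    · subst hj; simp
    · have : i₀ < j := Fin.lt_def.2 (by rw [h0]; exact Nat.pos_of_ne_zero fun h => hj (Fin.ext (by omega)))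
      rw [b.repr_apply_apply, ← hx, hb this]
      simp [hj]
  · ext j
    by_cases hj : j = i₀
    · subst hj; simp [h01]
    · by_cases hj' : j = i₁
      · subst hj'; simp [h01.symm]
      · have : i₁ < j := Fin.lt_def.2 (by
          have a1 : (j : ℕ) ≠ 0 := fun h => hj (Fin.ext (by omega))
          have a2 : (j : ℕ) ≠ 1 := fun h => hj' (Fin.ext (by omega))
          omega)
        rw [b.repr_apply_apply, ← hy, hb this]
        simp [hj, hj']

/-- By invariance one may take x = αe₀ and y = βe₀ + γe₁. The kernel is then α^(k+l) times a binary
form in (β, γ), and the reflection e₁ ↦ -e₁ leaves only even powers of γ. Finally αβ = ⟨x,y⟩ and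
(αγ)² = |x|²|y|² - ⟨x,y⟩². -/
theorem exists_radonKernel_eq (hm : 2 ≤ m) (k l : ℕ) :
    ∃ c : ℕ → ℂ, ∀ x y : EuclideanSpace ℝ (Fin m), radonKernel k l x y =
      ∑ j ∈ Finset.range ((k + l) / 2 + 1), c j * ((inner ℝ x y : ℂ) ^ (k + l - 2 * j) *
        ((‖x‖ : ℂ) ^ 2 * (‖y‖ : ℂ) ^ 2 - (inner ℝ x y : ℂ) ^ 2) ^ j) := by
  set i₀ : Fin m := ⟨0, by omega⟩ with hi₀
  set i₁ : Fin m := ⟨1, by omega⟩ with hi₁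
  have h01 : i₀ ≠ i₁ := fun h => by simp [hi₀, hi₁] at h
  set e₀ : EuclideanSpace ℝ (Fin m) := EuclideanSpace.single i₀ 1 with he₀
  set e₁ : EuclideanSpace ℝ (Fin m) := EuclideanSpace.single i₁ 1 with he₁
  let f : ℂ → ℂ → ℂ := fun β γ => frameMeanLM (by omega : 1 ≤ m)
    ((tauCoord i₀ ^ k * tauDaggerCoord i₀ ^ l) * ((β • tauCoord i₀ + γ • tauCoord i₁) ^ l *
      (β • tauDaggerCoord i₀ + γ • tauDaggerCoord i₁) ^ k))
  have hf : IsBinaryForm (l + k) f :=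
    ((isBinaryForm_linear_pow_mul _ _ _ _ l k).mul_left _).map _
  rw [add_comm] at hf
  have hp : ∀ (α β γ : ℝ), radonKernel k l (α • e₀) (β • e₀ + γ • e₁) =
      (α : ℂ) ^ (k + l) * f β γ := by
    intro α β γ
    rw [radonKernel, dualRadon_eq_frameMean]
    simp only [f]
    rw [← smul_eq_mul ((α : ℂ) ^ (k + l)), ← map_smul]
    change frameMean _ = frameMean _
    congr 1
    funext p
    have h1 : ∀ v, pairing (α • e₀) v = α * v i₀ := by
      intro v
      simp [pairing, he₀, apply_ite Complex.ofReal, ite_mul]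
    have h2 : ∀ v, pairing (β • e₀ + γ • e₁) v = β * v i₀ + γ * v i₁ := by
      intro v
      simp [pairing, he₀, he₁, apply_ite Complex.ofReal, ite_mul, add_mul,
        Finset.sum_add_distrib]
    simp only [h1, h2, ContinuousMap.smul_apply, ContinuousMap.mul_apply, ContinuousMap.pow_apply,
      ContinuousMap.add_apply, smul_eq_mul, tauCoord, tauDaggerCoord, ContinuousMap.coe_mk]
    ring
  obtain ⟨c, hc⟩ := hf.eq_even
  refine ⟨c, fun x y => ?_⟩
  obtain ⟨g, α, β, γ, hx, hy⟩ := exists_isometry_plane (i₀ := i₀) (i₁ := i₁) rfl rfl x y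
  have heven : (α : ℂ) ^ (k + l) * f β γ = (α : ℂ) ^ (k + l) * f β (-γ) := by
    have hn := hp α β (-γ)
    rw [Complex.ofReal_neg] at hn
    rw [← hp, ← hn, ← radonKernel_map k l (perp e₁).reflection]
    have r1 : (perp e₁).reflection e₁ = -e₁ :=
      Submodule.reflection_orthogonalComplement_singleton_eq_neg e₁
    have r0 : (perp e₁).reflection e₀ = e₀ := by
      refine Submodule.reflection_mem_subspace_eq_self
        (Submodule.mem_orthogonal_singleton_iff_inner_right.2 ?_)
      simp [he₀, he₁, h01.symm, EuclideanSpace.inner_single_left]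
    simp only [map_add, map_smul, r0, r1, smul_neg, neg_smul]
  have hin : inner ℝ x y = α * β := by
    rw [← g.inner_map_map, hx, hy]
    simp [inner_add_right, inner_smul_left, inner_smul_right, h01.symm,
      EuclideanSpace.inner_single_left, mul_comm]
  have hnx : ‖x‖ ^ 2 = α ^ 2 := by
    rw [← g.norm_map, hx, norm_smul, mul_pow]
    simp
  have hny : ‖y‖ ^ 2 = β ^ 2 + γ ^ 2 := by
    rw [← g.norm_map, hy, EuclideanSpace.real_norm_sq_eq,
      Finset.sum_eq_add i₀ i₁ h01 (fun j _ hj => by simp [hj.1, hj.2])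
      (by simp) (by simp)]
    simp [h01, h01.symm]
  have hnx' : (‖x‖ : ℂ) ^ 2 = (α : ℂ) ^ 2 := by exact_mod_cast hnx
  have hny' : (‖y‖ : ℂ) ^ 2 = (β : ℂ) ^ 2 + (γ : ℂ) ^ 2 := by exact_mod_cast hny
  rw [← radonKernel_map k l g, hx, hy, hp, hin, hnx', hny']
  -- For α = 0 the factor α^(k+l) cannot be cancelled, but then both sides vanish unless k + l = 0.
  rcases eq_or_ne α 0 with hα | hα
  · subst hα
    rcases Nat.eq_zero_or_pos (k + l) with hN | hN
    · rw [hN, pow_zero, one_mul]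
      rw [hN, pow_zero, one_mul, one_mul] at heven
      rw [hc _ _ heven, hN]
      simp
    · rw [Complex.ofReal_zero, zero_pow hN.ne', zero_mul]
      symm
      refine Finset.sum_eq_zero fun j _ => ?_
      rcases Nat.eq_zero_or_pos j with rfl | hj
      · simp only [Nat.mul_zero, Nat.sub_zero, pow_zero, mul_one, Complex.ofReal_zero, zero_mul]
        rw [zero_pow hN.ne', mul_zero]
      · simp [hj.ne']
  · have hα' : (α : ℂ) ^ (k + l) ≠ 0 := pow_ne_zero _ (by exact_mod_cast hα)
    rw [hc _ _ (mul_left_cancel₀ hα' heven), Finset.mul_sum]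
    refine Finset.sum_congr rfl fun j hj => ?_
    rw [Finset.mem_range] at hj
    obtain ⟨d, hd⟩ := Nat.exists_eq_add_of_le (show 2 * j ≤ k + l by omega)
    rw [hd, Nat.add_sub_cancel_left]
    push_cast
    rw [show (α : ℂ) ^ 2 * (β ^ 2 + γ ^ 2) - (α * β) ^ 2 = (α * γ) ^ 2 by ring]
    ring

/-- Binomial expansion of (|x|²|y|² - ⟨x,y⟩²)^j yields only monomials with equal powers of |x|² and
|y|², all of degree k + l in each vector. -/
theorem radonPoly_mem_zonalSpan (hm : 3 ≤ m) (k l : ℕ) :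
    radonPoly (by omega : 1 ≤ m) k l ∈ zonalSpan m (k + l) := by
  obtain ⟨c, hc⟩ := exists_radonKernel_eq (by omega : 2 ≤ m) k l
  have h : radonPoly (by omega : 1 ≤ m) k l = ∑ j ∈ Finset.range ((k + l) / 2 + 1),
      c j • (innerXY m ℂ ^ (k + l - 2 * j) *
        (normSqX m ℂ * normSqY m ℂ - innerXY m ℂ ^ 2) ^ j) := by
    refine ext_realPoint fun x y => ?_
    rw [eval_radonPoly, hc]
    simp [smul_eval, eval_normSqX, eval_normSqY, eval_innerXY]
  rw [h]
  refine Submodule.sum_mem _ fun j hj => Submodule.smul_mem _ _ ?_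
  rw [Finset.mem_range] at hj
  rw [sub_eq_add_neg, add_pow, Finset.mul_sum]
  refine Submodule.sum_mem _ fun i hi => ?_
  rw [Finset.mem_range] at hi
  have := Submodule.smul_mem _ ((-1 : ℂ) ^ (j - i) * (j.choose i : ℂ))
    (monomial_mem_zonalSpan hm (k + l) (k + l - 2 * i) i (by omega))
  convert this using 1
  rw [show k + l - 2 * i = (k + l - 2 * j) + 2 * (j - i) by omega, smul_eq_C_mul, neg_pow,
    pow_add, pow_mul, mul_pow]
  simp only [map_mul, map_pow, map_neg, map_one, map_natCast]
  ring

end Invariance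

/-! ### Closed forms of the coefficients and their recurrences -/

section Coefficients

/-- The value of `θ_{n,k,l}`. -/
noncomputable def radonCoeff (m k l n : ℕ) : ℝ :=
  ((-1 : ℝ) ^ (k + l) *
    (Real.Gamma ((m : ℝ) - 1) * Real.Gamma ((m : ℝ) / 2 + k - n - 1) *
        Real.Gamma ((m : ℝ) / 2 + l - n - 1) * ((m : ℝ) - 2) /
      (4 * (Nat.factorial (l - n) : ℝ) * Real.Gamma ((m : ℝ) / 2 + k + l - n) ^ 2 *
        Real.Gamma ((m : ℝ) + k + l - 2 * n - 2))) *
    ((Nat.factorial k : ℝ) * (Nat.factorial l : ℝ) / (Nat.factorial n : ℝ)) ^ 2 *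
    ((Nat.factorial (k + l - 2 * n) : ℝ) / (Nat.factorial (k - n) : ℝ)))

/-- The coefficient of `⟨x, y⟩^(k+l)` in `L_{k,l}`. -/
noncomputable def topCoeff (m k l : ℕ) : ℝ :=
  (-2) ^ (k + l) * (Nat.factorial k : ℝ) * (Nat.factorial l : ℝ) *
    (ascPochhammer ℝ k).eval ((m : ℝ) / 2 - 1) * (ascPochhammer ℝ l).eval ((m : ℝ) / 2 - 1) /
    ((ascPochhammer ℝ (k + l)).eval ((m : ℝ) - 2) * (ascPochhammer ℝ (k + l)).eval ((m : ℝ) / 2))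

theorem Gamma_add_natCast {a : ℝ} (ha : 0 < a) (n : ℕ) :
    Real.Gamma (a + n) = (ascPochhammer ℝ n).eval a * Real.Gamma a := by
  induction n with
  | zero => simp
  | succ n ih =>
    rw [Nat.cast_succ, ← add_assoc, Real.Gamma_add_one (by positivity), ih, ascPochhammer_succ_eval]
    ring

theorem ascPochhammer_eval_mul_add (a : ℝ) (n : ℕ) :
    (ascPochhammer ℝ n).eval a * (a + n) = a * (ascPochhammer ℝ n).eval (a + 1) := by
  rw [← ascPochhammer_succ_eval, ascPochhammer_succ_left]
  simp

/-- Only n = 0 contributes to ⟨x,y⟩^(k+l). With a = m/2 - 1 all Gamma values reduce to rising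
factorials based at a, a + 1 and 2a. -/
theorem radonCoeff_zero_mul {m : ℕ} (hm : 3 ≤ m) (k l : ℕ) :
    radonCoeff m k l 0 * zonalCoeff m (k + l) 0 = topCoeff m k l := by
  have hm' : (3 : ℝ) ≤ m := by exact_mod_cast hm
  set a : ℝ := (m : ℝ) / 2 - 1 with ha
  have ha0 : 0 < a := by rw [ha]; linarith
  have hma : (m : ℝ) = 2 * a + 2 := by rw [ha]; ring
  have hP := ascPochhammer_eval_mul_add a (k + l)
  have hp0 : 0 < (ascPochhammer ℝ (k + l)).eval (a + 1) := ascPochhammer_pos _ _ (by linarith)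
  have hp1 : 0 < (ascPochhammer ℝ (k + l)).eval (2 * a) := ascPochhammer_pos _ _ (by linarith)
  have hG0 := Real.Gamma_pos_of_pos ha0
  have hG1 := Real.Gamma_pos_of_pos (by linarith : 0 < 2 * a)
  unfold radonCoeff zonalCoeff topCoeff
  rw [← ha, hma,
    show (2 * a + 2) - 1 = 2 * a + 1 by ring,
    show (2 * a + 2) / 2 + (k : ℝ) - (0 : ℕ) - 1 = a + k by push_cast; ring,
    show (2 * a + 2) / 2 + (l : ℝ) - (0 : ℕ) - 1 = a + l by push_cast; ring,
    show (2 * a + 2) / 2 + (k : ℝ) + l - (0 : ℕ) = (a + 1) + (k + l : ℕ) by push_cast; ring,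
    show 2 * a + 2 + (k : ℝ) + l - 2 * (0 : ℕ) - 2 = 2 * a + (k + l : ℕ) by push_cast; ring,
    show (2 * a + 2) - 2 = 2 * a by ring, show (2 * a + 2) / 2 = a + 1 by ring,
    Gamma_add_natCast ha0, Gamma_add_natCast ha0, Gamma_add_natCast (by linarith : 0 < a + 1),
    Gamma_add_natCast (by linarith : 0 < 2 * a), Real.Gamma_add_one ha0.ne',
    Real.Gamma_add_one (by linarith : 2 * a ≠ 0)]
  set p := (ascPochhammer ℝ (k + l)).eval a
  set q := (ascPochhammer ℝ (k + l)).eval (a + 1)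
  have hk : (Nat.factorial k : ℝ) ≠ 0 := by exact_mod_cast Nat.factorial_ne_zero k
  have hl : (Nat.factorial l : ℝ) ≠ 0 := by exact_mod_cast Nat.factorial_ne_zero l
  have hkl : (Nat.factorial (k + l) : ℝ) ≠ 0 := by exact_mod_cast Nat.factorial_ne_zero (k + l)
  simp only [Nat.sub_zero, Nat.mul_zero, Nat.factorial_zero, Nat.cast_one, pow_zero, one_mul,
    div_one]
  have h2 : (-2 : ℝ) ^ (k + l) = (-1) ^ (k + l) * 2 ^ (k + l) := by
    rw [← mul_pow]; norm_num
  have hp : 2 * ((k + l : ℕ) : ℝ) + (2 * a + 2) - 2 = 2 * (a + (k + l : ℕ)) := by ring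
  rw [h2, hp]
  field_simp
  linear_combination 4 * (ascPochhammer ℝ k).eval a * (ascPochhammer ℝ l).eval a * hP

theorem topCoeff_comm (m k l : ℕ) : topCoeff m k l = topCoeff m l k := by
  unfold topCoeff
  rw [add_comm k l]
  ring

theorem topCoeff_succ_left {m : ℕ} (hm : 3 ≤ m) (k l : ℕ) :
    topCoeff m (k + 1) l * (((m : ℝ) - 2 + k + l) * ((m : ℝ) / 2 + k + l)) =
      -2 * ((k : ℝ) + 1) * ((m : ℝ) / 2 - 1 + k) * topCoeff m k l := by
  have hm' : (3 : ℝ) ≤ m := by exact_mod_cast hm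
  have hp0 : 0 < (ascPochhammer ℝ (k + l)).eval ((m : ℝ) / 2) := ascPochhammer_pos _ _ (by linarith)
  have hp1 : 0 < (ascPochhammer ℝ (k + l)).eval ((m : ℝ) - 2) := ascPochhammer_pos _ _ (by linarith)
  have hk : (0 : ℝ) ≤ k := Nat.cast_nonneg k
  have hl : (0 : ℝ) ≤ l := Nat.cast_nonneg l
  have h1 : (0 : ℝ) < (m : ℝ) - 2 + k + l := by linarith
  have h2 : (0 : ℝ) < (m : ℝ) / 2 + k + l := by linarith
  unfold topCoeff
  rw [show k + 1 + l = k + l + 1 by omega, ascPochhammer_succ_eval, ascPochhammer_succ_eval,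
    ascPochhammer_succ_eval, Nat.factorial_succ]
  push_cast
  rw [← add_assoc, ← add_assoc]
  field_simp
  ring

/-- The evaluated ⟨∂_x,∂_y⟩ identity for l = 0, where no n = 1 term occurs. -/
theorem topCoeff_succ_zero_rec {m : ℕ} (hm : 3 ≤ m) (k : ℕ) :
    topCoeff m (k + 1) 0 * (((k : ℝ) + 1) * (m + (k + 1) - 1) -
      2 * (((k : ℝ) + 1) * (k + 1 - 1)) / (2 * (k + 1) + m - 4)) =
      -2 * ((k : ℝ) + 1) ^ 2 * topCoeff m k 0 := by
  have hm' : (3 : ℝ) ≤ m := by exact_mod_cast hm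
  have hk : (0 : ℝ) ≤ k := Nat.cast_nonneg k
  have h := topCoeff_succ_left hm k 0
  have h1 : (m : ℝ) - 2 + k ≠ 0 := ne_of_gt (by linarith)
  have h2 : (m : ℝ) + 2 * k ≠ 0 := ne_of_gt (by linarith)
  have h3 : 2 * ((k : ℝ) + 1) + m - 4 ≠ 0 := ne_of_gt (by linarith)
  have h4 : topCoeff m (k + 1) 0 = -2 * ((k : ℝ) + 1) * (2 * ((k : ℝ) + 1) + m - 4) *
      topCoeff m k 0 / (((m : ℝ) - 2 + k) * ((m : ℝ) + 2 * k)) := by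
    rw [eq_div_iff (mul_ne_zero h1 h2)]
    push_cast at h
    linear_combination 2 * h
  rw [h4]
  have h5 : 2 * ((k : ℝ) + 1) + m - 4 = (m : ℝ) - 2 + 2 * k := by ring
  rw [h5] at h3 ⊢
  field_simp
  ring

/-- The evaluated ⟨∂_x,∂_y⟩ identity for positive indices. The fraction with the squared denominator
is the n = 1 contribution 4 θ_1 times the leading coefficient of K_{m,k+l}, with θ_1 expressed
through L_{k,l}. -/
theorem topCoeff_succ_succ_rec {m : ℕ} (hm : 3 ≤ m) (k l : ℕ) :
    topCoeff m (k + 1) (l + 1) * (((k : ℝ) + l + 2) * (m + (k + l + 2) - 1) -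
      2 * (((k : ℝ) + l + 2) * (k + l + 2 - 1)) / (2 * (k + l + 2) + m - 4)) +
      16 * ((k : ℝ) + 1) ^ 2 * ((l : ℝ) + 1) ^ 2 * topCoeff m k l /
        (2 * (k + l + 2) + m - 4) ^ 2 =
      -2 * ((k : ℝ) + 1) ^ 2 * topCoeff m k (l + 1) -
        2 * ((l : ℝ) + 1) ^ 2 * topCoeff m (k + 1) l := by
  have hm' : (3 : ℝ) ≤ m := by exact_mod_cast hm
  have hk : (0 : ℝ) ≤ k := Nat.cast_nonneg k
  have hl : (0 : ℝ) ≤ l := Nat.cast_nonneg l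
  have r1 := topCoeff_succ_left hm k l
  have r2 := topCoeff_succ_left hm l k
  have r3 := topCoeff_succ_left hm k (l + 1)
  rw [topCoeff_comm m (l + 1) k, topCoeff_comm m l k] at r2
  push_cast at r3
  have h1 : (m : ℝ) - 2 + k + l ≠ 0 := ne_of_gt (by linarith)
  have h2 : (m : ℝ) + 2 * k + 2 * l ≠ 0 := ne_of_gt (by linarith)
  have h3 : (m : ℝ) - 1 + k + l ≠ 0 := ne_of_gt (by linarith)
  have h4 : (m : ℝ) + 2 * k + 2 * l + 2 ≠ 0 := ne_of_gt (by linarith)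
  have q1 : topCoeff m (k + 1) l = -2 * ((k : ℝ) + 1) * ((m : ℝ) - 2 + 2 * k) * topCoeff m k l /
      (((m : ℝ) - 2 + k + l) * ((m : ℝ) + 2 * k + 2 * l)) := by
    rw [eq_div_iff (mul_ne_zero h1 h2)]
    linear_combination 2 * r1
  have q2 : topCoeff m k (l + 1) = -2 * ((l : ℝ) + 1) * ((m : ℝ) - 2 + 2 * l) * topCoeff m k l /
      (((m : ℝ) - 2 + k + l) * ((m : ℝ) + 2 * k + 2 * l)) := by
    rw [eq_div_iff (mul_ne_zero h1 h2)]
    linear_combination 2 * r2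
  have q3 : topCoeff m (k + 1) (l + 1) =
      -2 * ((k : ℝ) + 1) * ((m : ℝ) - 2 + 2 * k) * topCoeff m k (l + 1) /
      (((m : ℝ) - 1 + k + l) * ((m : ℝ) + 2 * k + 2 * l + 2)) := by
    rw [eq_div_iff (mul_ne_zero h3 h4)]
    linear_combination 2 * r3
  rw [q3, q1, q2, show 2 * ((k : ℝ) + l + 2) + m - 4 = (m : ℝ) + 2 * k + 2 * l by ring]
  field_simp
  ring

/-- Raising k, l, n together changes only k!, l!, n! and the squared Gamma factor, whose argument
grows by one. -/
theorem radonCoeff_succ_succ {m : ℕ} (hm : 3 ≤ m) {k l n : ℕ} (hk : n ≤ k) (hl : n ≤ l) :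
    radonCoeff m (k + 1) (l + 1) (n + 1) *
        (2 * ((n : ℝ) + 1) * (2 * (n + 1) + 2 * ((k : ℝ) + l - 2 * n) + m - 2)) ^ 2 =
      16 * ((k : ℝ) + 1) ^ 2 * ((l : ℝ) + 1) ^ 2 * radonCoeff m k l n := by
  have hm' : (3 : ℝ) ≤ m := by exact_mod_cast hm
  have hk' : (n : ℝ) ≤ k := by exact_mod_cast hk
  have hl' : (n : ℝ) ≤ l := by exact_mod_cast hl
  have hn : (0 : ℝ) ≤ n := Nat.cast_nonneg n
  have hb : (0 : ℝ) < (m : ℝ) / 2 + k + l - n := by linarith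
  have hG := Real.Gamma_pos_of_pos hb
  have hG2 := Real.Gamma_pos_of_pos (by linarith : (0 : ℝ) < (m : ℝ) + k + l - 2 * n - 2)
  unfold radonCoeff
  rw [show k + 1 - (n + 1) = k - n by omega, show l + 1 - (n + 1) = l - n by omega,
    show k + 1 + (l + 1) - 2 * (n + 1) = k + l - 2 * n by omega,
    show k + 1 + (l + 1) = k + l + 2 by omega, Nat.factorial_succ, Nat.factorial_succ,
    Nat.factorial_succ]
  push_cast
  rw [show (m : ℝ) / 2 + (k + 1) - (n + 1) - 1 = (m : ℝ) / 2 + k - n - 1 by ring,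
    show (m : ℝ) / 2 + (l + 1) - (n + 1) - 1 = (m : ℝ) / 2 + l - n - 1 by ring,
    show (m : ℝ) / 2 + (k + 1) + (l + 1) - (n + 1) = (m : ℝ) / 2 + k + l - n + 1 by ring,
    show (m : ℝ) + (k + 1) + (l + 1) - 2 * (n + 1) - 2 = (m : ℝ) + k + l - 2 * n - 2 by ring,
    Real.Gamma_add_one hb.ne',
    show 2 * ((n : ℝ) + 1) * (2 * (n + 1) + 2 * ((k : ℝ) + l - 2 * n) + m - 2) =
      4 * (n + 1) * ((m : ℝ) / 2 + k + l - n) by ring]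
  have e1 : (Nat.factorial (l - n) : ℝ) ≠ 0 := by exact_mod_cast Nat.factorial_ne_zero _
  have e2 : (Nat.factorial (k - n) : ℝ) ≠ 0 := by exact_mod_cast Nat.factorial_ne_zero _
  have e3 : (Nat.factorial n : ℝ) ≠ 0 := by exact_mod_cast Nat.factorial_ne_zero _
  have e4 : (n : ℝ) + 1 ≠ 0 := by positivity
  have e5 := hb.ne'
  set b := (m : ℝ) / 2 + k + l - n
  field_simp
  ring

end Coefficients

/-! ### Determination of the coefficients by induction on k + l -/

section Expansion

variable {m : ℕ}

theorem mixedLaplacian_iterate_expansion (N : ℕ) (c : ℕ → ℂ) :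
    mixedLaplacian Sum.inr Sum.inr (mixedLaplacian Sum.inl Sum.inl
      (∑ n ∈ Finset.range (N / 2 + 1),
        C (c n) * (zonalPoly m (N - 2 * n) * normSqX m ℂ ^ n * normSqY m ℂ ^ n))) =
      ∑ n ∈ Finset.range (N / 2),
        C (c (n + 1) * (2 * ((n : ℂ) + 1) *
          (2 * (n + 1) + 2 * ((N - 2 * (n + 1) : ℕ) : ℂ) + m - 2)) ^ 2) *
          (zonalPoly m (N - 2 - 2 * n) * normSqX m ℂ ^ n * normSqY m ℂ ^ n) := by
  simp only [map_sum, ← smul_eq_C_mul, map_smul, mixedLaplacian_inr_inr_inl_inl_zonalPoly]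
  rw [Finset.sum_range_succ']
  simp only [smul_eq_C_mul, Nat.cast_zero, mul_zero, zero_mul, ne_eq, OfNat.ofNat_ne_zero,
    not_false_eq_true, zero_pow, map_zero, add_zero]
  refine Finset.sum_congr rfl fun n _ => ?_
  rw [← mul_assoc, ← C_mul, show N - 2 * (n + 1) = N - 2 - 2 * n by omega, Nat.add_sub_cancel,
    Nat.cast_succ]

theorem eval_expansion (N : ℕ) (c : ℕ → ℂ) (a : Fin m ⊕ Fin m → ℂ)
    (hx : eval a (normSqX m ℂ) = 0) (hy : eval a (normSqY m ℂ) = 1)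
    (hu : eval a (innerXY m ℂ) = 1) :
    eval a (∑ n ∈ Finset.range (N / 2 + 1),
        C (c n) * (zonalPoly m (N - 2 * n) * normSqX m ℂ ^ n * normSqY m ℂ ^ n)) =
      c 0 * zonalCoeff m N 0 := by
  rw [map_sum, Finset.sum_range_succ', Finset.sum_eq_zero]
  · simp [eval_zonalPoly_eq m N a hy hu, hx, ← Polynomial.coeff_zero_eq_eval_zero,
      zonalUnivariate_coeff_zero]
  · intro n _
    simp [hx]

theorem eval_mixedLaplacian_expansion (hm : 3 ≤ m) (N : ℕ) (c : ℕ → ℂ) (a : Fin m ⊕ Fin m → ℂ)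
    (hx : eval a (normSqX m ℂ) = 0) (hy : eval a (normSqY m ℂ) = 1)
    (hu : eval a (innerXY m ℂ) = 1) :
    eval a (mixedLaplacian Sum.inl Sum.inr (∑ n ∈ Finset.range (N / 2 + 1),
        C (c n) * (zonalPoly m (N - 2 * n) * normSqX m ℂ ^ n * normSqY m ℂ ^ n))) =
      c 0 * (((N * (m + N - 1) - 2 * (N * (N - 1)) / (2 * N + m - 4)) * zonalCoeff m N 0 : ℝ) : ℂ) +
        if 2 ≤ N then c 1 * (4 * zonalCoeff m (N - 2) 0) else 0 := by
  simp only [map_sum, ← smul_eq_C_mul, map_smul, smul_eval,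
    eval_mixedLaplacian_zonalPoly hm _ _ a hx hy hu]
  rw [Finset.sum_range_succ']
  simp only [Nat.add_eq_zero_iff, one_ne_zero, and_false, if_false, Nat.add_eq_right,
    if_true, mul_zero, Nat.sub_zero]
  rw [add_comm]
  congr 1
  split_ifs with h
  · rw [Finset.sum_eq_single_of_mem 0 (Finset.mem_range.2 (by omega))]
    · simp
    · intro n _ hn
      simp [hn]
  · rw [show N / 2 = 0 by omega, Finset.sum_range_zero]

/-- The coefficient sequence of `L_{k,l}`, extended by zero. -/
noncomputable def extendedCoeff (m k l n : ℕ) : ℂ :=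
  if n ≤ min k l then (radonCoeff m k l n : ℂ) else 0

theorem extendedCoeff_zero_mul (hm : 3 ≤ m) (k l : ℕ) :
    extendedCoeff m k l 0 * zonalCoeff m (k + l) 0 = topCoeff m k l := by
  rw [extendedCoeff, if_pos (Nat.zero_le _), ← Complex.ofReal_mul, radonCoeff_zero_mul hm]

theorem topCoeff_zero_zero (m : ℕ) : topCoeff m 0 0 = 1 := by
  simp [topCoeff]

theorem radonPoly_eq_sum (hm : 3 ≤ m) (k l : ℕ) :
    radonPoly (by omega : 1 ≤ m) k l = ∑ n ∈ Finset.range ((k + l) / 2 + 1),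
      C (extendedCoeff m k l n) *
        (zonalPoly m (k + l - 2 * n) * normSqX m ℂ ^ n * normSqY m ℂ ^ n) := by
  have hm' : (3 : ℝ) ≤ m := by exact_mod_cast hm
  induction hN : k + l using Nat.strong_induction_on generalizing k l with
  | _ N ih =>
  subst hN
  obtain ⟨c, hc⟩ := mem_zonalSpan_iff.1 (radonPoly_mem_zonalSpan hm k l)
  -- At this isotropic point a kernel evaluates to its coefficient of ⟨x,y⟩^(k+l), so lower kernels
  -- are known by induction.
  obtain ⟨a, hx, hy, hu⟩ := exists_eval_normSqX_eq (by omega : 2 ≤ m) (0 : ℂ)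
  have hev : ∀ k' l', k' + l' < k + l →
      eval a (radonPoly (by omega : 1 ≤ m) k' l') = topCoeff m k' l' := by
    intro k' l' h
    rw [ih _ h k' l' rfl, eval_expansion _ _ a hx hy hu, extendedCoeff_zero_mul hm]
  have hΔ := mixedLaplacian_radonPoly_iterate (by omega : 1 ≤ m) k l
  rw [hc, mixedLaplacian_iterate_expansion] at hΔ
  have hΛ := congrArg (eval a) (mixedLaplacian_inl_inr_radonPoly (by omega : 1 ≤ m) k l)
  rw [hc, eval_mixedLaplacian_expansion hm _ _ a hx hy hu] at hΛ
  simp only [map_sub, map_mul, map_neg, map_natCast] at hΛ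
  have hpos : (zonalCoeff m (k + l) 0 : ℂ) ≠ 0 := by
    exact_mod_cast (zonalCoeff_zero_pos hm _).ne'
  have heig : ∀ n : ℕ, (2 * ((n : ℂ) + 1) *
      (2 * (n + 1) + 2 * ((k + l - 2 * (n + 1) : ℕ) : ℂ) + m - 2)) ^ 2 ≠ 0 := by
    intro n
    have h0 : (0 : ℝ) ≤ ((k + l - 2 * (n + 1) : ℕ) : ℝ) := Nat.cast_nonneg _
    have h1 : (0 : ℝ) ≤ n := Nat.cast_nonneg _
    have : (2 * ((n : ℝ) + 1) *
      (2 * (n + 1) + 2 * ((k + l - 2 * (n + 1) : ℕ) : ℝ) + m - 2)) ^ 2 ≠ 0 :=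
      pow_ne_zero _ (mul_ne_zero (by positivity) (ne_of_gt (by linarith)))
    exact_mod_cast this
  -- All coefficients except the zeroth come from Δ_x Δ_y by independence: the right-hand side is
  -- zero if kl = 0 and a lower kernel otherwise.
  have hsucc : ∀ n < (k + l) / 2, c (n + 1) = extendedCoeff m k l (n + 1) := by
    intro n hn
    rcases Nat.eq_zero_or_pos (k * l) with h0 | h0
    · rw [show 16 * k ^ 2 * l ^ 2 = 16 * (k * l) ^ 2 by ring, h0] at hΔ
      have h := zonalPoly_independent hm _ _ _ (hΔ.trans (by simp)) n hn
      rw [(mul_eq_zero.1 h).resolve_right (heig n), extendedCoeff, if_neg]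
      rcases Nat.mul_eq_zero.1 h0 with rfl | rfl <;> simp
    · obtain ⟨k, rfl⟩ := Nat.exists_eq_succ_of_ne_zero (Nat.pos_of_mul_pos_right h0).ne'
      obtain ⟨l, rfl⟩ := Nat.exists_eq_succ_of_ne_zero (Nat.pos_of_mul_pos_left h0).ne'
      simp only [Nat.succ_eq_add_one, Nat.add_sub_cancel] at hΔ hn ⊢
      rw [ih (k + l) (by omega) k l rfl, Finset.mul_sum,
        show (k + l) / 2 + 1 = (k + 1 + (l + 1)) / 2 by omega, ← sub_eq_zero,
        ← Finset.sum_sub_distrib] at hΔ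
      have h := zonalPoly_independent hm (k + l) _
        (fun n => c (n + 1) * (2 * ((n : ℂ) + 1) *
          (2 * (n + 1) + 2 * ((k + 1 + (l + 1) - 2 * (n + 1) : ℕ) : ℂ) + m - 2)) ^ 2 -
          ((16 * (k + 1) ^ 2 * (l + 1) ^ 2 : ℕ) : ℂ) * extendedCoeff m k l n)
        (by
          rw [← hΔ]
          refine Finset.sum_congr rfl fun n _ => ?_
          rw [map_sub, C_mul (a := ((16 * (k + 1) ^ 2 * (l + 1) ^ 2 : ℕ) : ℂ)), map_natCast,
            show k + 1 + (l + 1) - 2 - 2 * n = k + l - 2 * n by omega]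
          ring) n hn
      refine mul_right_cancel₀ (heig n) ((sub_eq_zero.1 h).trans ?_)
      unfold extendedCoeff
      by_cases hnk : n ≤ min k l
      · rw [if_pos hnk, if_pos (by omega)]
        have := radonCoeff_succ_succ hm (hnk.trans (min_le_left _ _)) (hnk.trans (min_le_right _ _))
        rw [show k + 1 + (l + 1) - 2 * (n + 1) = k + l - 2 * n by omega, Nat.cast_sub (by omega)]
        push_cast
        exact_mod_cast this.symm
      · rw [if_neg hnk, if_neg (by omega)]
        simp
  -- The remaining coefficient solves a linear equation whose factor equals N(N + m - 3)(2N + m -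
  -- 2)/(2N + m - 4), nonzero for N ≥ 1; N = 0 is the normalization of the mean.
  have htop : c 0 * zonalCoeff m (k + l) 0 = topCoeff m k l := by
    have hA : ∀ N : ℕ, 1 ≤ N →
        ((N * (m + N - 1) - 2 * (N * (N - 1)) / (2 * N + m - 4) : ℝ) : ℂ) ≠ 0 := by
      intro N hN
      have hN' : (1 : ℝ) ≤ N := by exact_mod_cast hN
      have hD : (0 : ℝ) < 2 * N + m - 4 := by linarith
      have : (N * (m + N - 1) - 2 * (N * (N - 1)) / (2 * N + m - 4) : ℝ) =
          N * (N + m - 3) * (2 * N + m - 2) / (2 * N + m - 4) := by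
        rw [eq_div_iff hD.ne', sub_mul, div_mul_cancel₀ _ hD.ne']
        ring
      rw [Complex.ofReal_ne_zero, this]
      exact ne_of_gt (div_pos (mul_pos (mul_pos (by linarith) (by linarith)) (by linarith)) hD)
    have hA' := hA (k + l)
    rcases k with _ | k
    · rcases l with _ | l
      · have := congrArg (eval a) hc
        rw [radonPoly_zero_zero (by omega), eval_expansion _ _ a hx hy hu, map_one] at this
        rw [← this, topCoeff_zero_zero, Complex.ofReal_one]
      · have hrec := congrArg (fun z : ℝ => (z : ℂ)) (topCoeff_succ_zero_rec hm l)
        rw [topCoeff_comm, topCoeff_comm m l] at hrec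
        have h0 : (if 2 ≤ 0 + (l + 1) then
            c 1 * (4 * (zonalCoeff m (0 + (l + 1) - 2) 0 : ℂ)) else 0) = 0 := by
          split_ifs with h
          · rw [hsucc 0 (by omega), extendedCoeff, if_neg (by simp), zero_mul]
          · rfl
        rw [h0, hev 0 (l + 1 - 1) (by omega)] at hΛ
        refine mul_right_cancel₀ (hA' (by omega)) ?_
        simp only [Nat.add_sub_cancel] at hΛ
        push_cast at hΛ hrec ⊢
        simp only [zero_add] at hΛ hrec ⊢
        linear_combination hΛ - hrec
    · rcases l with _ | l
      · have hrec := congrArg (fun z : ℝ => (z : ℂ)) (topCoeff_succ_zero_rec hm k)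
        have h0 : (if 2 ≤ k + 1 + 0 then
            c 1 * (4 * (zonalCoeff m (k + 1 + 0 - 2) 0 : ℂ)) else 0) = 0 := by
          split_ifs with h
          · rw [hsucc 0 (by omega), extendedCoeff, if_neg (by simp), zero_mul]
          · rfl
        rw [h0, hev (k + 1 - 1) 0 (by omega)] at hΛ
        refine mul_right_cancel₀ (hA' (by omega)) ?_
        simp only [Nat.add_sub_cancel] at hΛ
        push_cast at hΛ hrec ⊢
        simp only [add_zero] at hΛ hrec ⊢
        linear_combination hΛ - hrec
      · have hrec := congrArg (fun z : ℝ => (z : ℂ)) (topCoeff_succ_succ_rec hm k l)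
        have h1 : c 1 * (4 * (zonalCoeff m (k + l) 0 : ℂ)) =
            ((16 * ((k : ℝ) + 1) ^ 2 * ((l : ℝ) + 1) ^ 2 * topCoeff m k l /
              (2 * (k + l + 2) + m - 4) ^ 2 : ℝ) : ℂ) := by
          have hD : 2 * ((k : ℝ) + l + 2) + m - 4 ≠ 0 := by
            have h3 : (0 : ℝ) ≤ k := Nat.cast_nonneg k
            have h4 : (0 : ℝ) ≤ l := Nat.cast_nonneg l
            exact ne_of_gt (by linarith)
          have h2 := radonCoeff_succ_succ hm (Nat.zero_le k) (Nat.zero_le l)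
          rw [hsucc 0 (by omega), extendedCoeff, if_pos (by simp)]
          have h5 : radonCoeff m (k + 1) (l + 1) (0 + 1) * (4 * zonalCoeff m (k + l) 0) =
              16 * ((k : ℝ) + 1) ^ 2 * ((l : ℝ) + 1) ^ 2 * topCoeff m k l /
                (2 * (k + l + 2) + m - 4) ^ 2 := by
            rw [eq_div_iff (pow_ne_zero 2 hD), ← radonCoeff_zero_mul hm]
            push_cast at h2
            linear_combination zonalCoeff m (k + l) 0 * h2
          exact_mod_cast h5
        rw [if_pos (by omega), show k + 1 + (l + 1) - 2 = k + l by omega, h1,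
          hev (k + 1 - 1) (l + 1) (by omega), hev (k + 1) (l + 1 - 1) (by omega)] at hΛ
        refine mul_right_cancel₀ (hA' (by omega)) ?_
        simp only [Nat.add_sub_cancel] at hΛ
        push_cast at hΛ hrec ⊢
        have e1 : (k : ℂ) + 1 + (l + 1) = k + l + 2 := by ring
        rw [e1] at hΛ ⊢
        linear_combination hΛ - hrec
  rw [hc]
  refine Finset.sum_congr rfl fun n hn => ?_
  rcases n with _ | n
  · rw [mul_right_cancel₀ hpos (htop.trans (extendedCoeff_zero_mul hm k l).symm)]
  · rw [hsucc n (by rw [Finset.mem_range] at hn; omega)]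

end Expansion

/-! ### Values of the zonal polynomials at real points -/

section Zonal

variable {m : ℕ}

theorem eval_zonalPoly (r : ℕ) (x y : EuclideanSpace ℝ (Fin m)) :
    eval (realPoint x y) (zonalPoly m r) = (zonal m r x y : ℂ) := by
  have h : eval (realPoint x y) (zonalPoly m r) =
      ((∑ j ∈ Finset.range (r / 2 + 1), zonalCoeff m r j *
        (inner ℝ x y ^ (r - 2 * j) * (‖x‖ ^ 2) ^ j * (‖y‖ ^ 2) ^ j) : ℝ) : ℂ) := by
    simp [zonalPoly, eval_normSqX, eval_normSqY, eval_innerXY]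
  rw [h, Complex.ofReal_inj, zonal, gegenbauer, Finset.mul_sum]
  refine Finset.sum_congr rfl fun j hj => ?_
  have hj' : 2 * j ≤ r := by rw [Finset.mem_range] at hj; omega
  rw [zonalCoeff]
  obtain ⟨d, rfl⟩ := Nat.exists_eq_add_of_le hj'
  rw [Nat.add_sub_cancel_left]
  have key : inner ℝ x y ^ d * (‖x‖ ^ 2) ^ j * (‖y‖ ^ 2) ^ j =
      ‖x‖ ^ (2 * j + d) * ‖y‖ ^ (2 * j + d) * (inner ℝ x y / (‖x‖ * ‖y‖)) ^ d := by
    -- If x or y is zero, the quotient is 0 by convention and both sides vanish, so the formula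
    -- agrees with the polynomial extension there too.
    have h1 : inner ℝ x y = ‖x‖ * ‖y‖ * (inner ℝ x y / (‖x‖ * ‖y‖)) := by
      rcases eq_or_ne x 0 with rfl | hx
      · simp
      rcases eq_or_ne y 0 with rfl | hy
      · simp
      · have := norm_ne_zero_iff.2 hx
        have := norm_ne_zero_iff.2 hy
        field_simp
    conv_lhs => rw [h1]
    rw [mul_pow, mul_pow]
    ring
  rw [key, mul_pow]
  ring

end Zonal
end HuaRadon

theorem mainTheorem6 (m : ℕ) (hm : 3 ≤ m) (k l : ℕ) (θ : ℕ → ℂ) :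
    (∀ x y : EuclideanSpace ℝ (Fin m),
      HuaRadon.dualRadon (fun τ : Fin m → ℂ =>
          HuaRadon.pairing x τ ^ k * HuaRadon.pairing x (HuaRadon.dagger τ) ^ l *
            (HuaRadon.pairing y τ ^ l * HuaRadon.pairing y (HuaRadon.dagger τ) ^ k)) =
        ∑ n ∈ Finset.range (min k l + 1),
          θ n * (‖x‖ : ℂ) ^ (2 * n) * (HuaRadon.zonal m (k + l - 2 * n) x y : ℂ) *
            (‖y‖ : ℂ) ^ (2 * n)) ↔
    ∀ n ≤ min k l,
      θ n =
        (((-1 : ℝ) ^ (k + l) *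
          (Real.Gamma ((m : ℝ) - 1) * Real.Gamma ((m : ℝ) / 2 + k - n - 1) *
              Real.Gamma ((m : ℝ) / 2 + l - n - 1) * ((m : ℝ) - 2) /
            (4 * (Nat.factorial (l - n) : ℝ) * Real.Gamma ((m : ℝ) / 2 + k + l - n) ^ 2 *
              Real.Gamma ((m : ℝ) + k + l - 2 * n - 2))) *
          ((Nat.factorial k : ℝ) * (Nat.factorial l : ℝ) / (Nat.factorial n : ℝ)) ^ 2 *
          ((Nat.factorial (k + l - 2 * n) : ℝ) / (Nat.factorial (k - n) : ℝ)) : ℝ) : ℂ) := by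
  have heval : ∀ (θ : ℕ → ℂ) (x y : EuclideanSpace ℝ (Fin m)),
      MvPolynomial.eval (HuaRadon.realPoint x y) (∑ n ∈ Finset.range (min k l + 1),
        MvPolynomial.C (θ n) * (HuaRadon.zonalPoly m (k + l - 2 * n) *
          HuaRadon.normSqX m ℂ ^ n * HuaRadon.normSqY m ℂ ^ n)) =
      ∑ n ∈ Finset.range (min k l + 1),
          θ n * (‖x‖ : ℂ) ^ (2 * n) * (HuaRadon.zonal m (k + l - 2 * n) x y : ℂ) *
            (‖y‖ : ℂ) ^ (2 * n) := by
    intro θ x y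
    rw [map_sum]
    refine Finset.sum_congr rfl fun n _ => ?_
    simp only [map_mul, map_pow, MvPolynomial.eval_C, HuaRadon.eval_zonalPoly,
      HuaRadon.eval_normSqX, HuaRadon.eval_normSqY]
    ring
  -- The terms with min(k, l) < n ≤ (k + l)/2 have coefficient zero and are dropped.
  have hexp : HuaRadon.radonPoly (by omega : 1 ≤ m) k l =
      ∑ n ∈ Finset.range (min k l + 1), MvPolynomial.C (HuaRadon.radonCoeff m k l n : ℂ) *
        (HuaRadon.zonalPoly m (k + l - 2 * n) *
          HuaRadon.normSqX m ℂ ^ n * HuaRadon.normSqY m ℂ ^ n) := by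
    rw [HuaRadon.radonPoly_eq_sum hm k l]
    symm
    refine Finset.sum_subset_zero_on_sdiff (Finset.range_mono (by omega)) (fun n hn => ?_)
      fun n hn => ?_
    · rw [Finset.mem_sdiff, Finset.mem_range, Finset.mem_range] at hn
      rw [HuaRadon.extendedCoeff, if_neg (by omega), map_zero, zero_mul]
    · rw [Finset.mem_range] at hn
      rw [HuaRadon.extendedCoeff, if_pos (by omega)]
  constructor
  · intro h
    have hpoly : HuaRadon.radonPoly (by omega : 1 ≤ m) k l =
        ∑ n ∈ Finset.range (min k l + 1), MvPolynomial.C (θ n) *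
          (HuaRadon.zonalPoly m (k + l - 2 * n) *
            HuaRadon.normSqX m ℂ ^ n * HuaRadon.normSqY m ℂ ^ n) := by
      refine HuaRadon.ext_realPoint fun x y => ?_
      rw [HuaRadon.eval_radonPoly, heval]
      exact h x y
    rw [hexp, ← sub_eq_zero, ← Finset.sum_sub_distrib] at hpoly
    intro n hn
    have := HuaRadon.zonalPoly_independent hm (k + l) (min k l + 1)
      (fun n => (HuaRadon.radonCoeff m k l n : ℂ) - θ n)
      (by simpa only [map_sub, sub_mul] using hpoly) n (by omega)
    exact (sub_eq_zero.1 this).symm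
  · intro h x y
    have hθ := HuaRadon.eval_radonPoly (by omega : 1 ≤ m) k l x y
    rw [hexp, heval] at hθ
    refine hθ.symm.trans (Finset.sum_congr rfl fun n hn => ?_)
    rw [h n (by rw [Finset.mem_range] at hn; omega)]
    rfl
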